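/- **Proposition.** Let $n\ge 1$, let $N$ be a smooth $n$-dimensional manifold, let $\vartheta$ be the tautological 1-form of $T^*N$, $\vartheta_\beta(v)=\beta(d\pi(v))$ with $\pi:T^*N\to N$ the projection, and let $\Omega=d\vartheta$ be the canonical symplectic form. Let $H:\mathcal U\to\mathbb R$ be a smooth function on an open subset $\mathcal U\subset T^*N$, and let $u\in\mathcal U$ be a point of non-degeneracy of $H$, i.e. $dH|_u\neq 0$. Denote by $\mathfrak{sp}^H$ the Lie algebra of germs at $u$ of smooth vector fields $Y$ with $$\mathcal L_Y\Omega=0,\qquad \iota_Y dH=0 .$$ Let $\Omega_o=dx^1\wedge dx^2+dx^3\wedge dx^4+\dots+dx^{2n-1}\wedge dx^{2n}$ be the standard symplectic form of $\mathbb R^{2n}$, and denote by $\mathfrak{sp}^{(1)}_\infty(2n,\mathbb R)$ the Lie algebra of germs at $0$ of smooth vector fields $X$ on $\mathbb R^{2n}$ with $$\mathcal L_X\Omega_o=0,\qquad \Big[\frac{\partial}{\partial x^1},X\Big]=0,\qquad dx^2(X)=0 .$$ Then $\mathfrak{sp}^{(1)}_\infty(2n,\mathbb R)$ is infinite-dimensional,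 and $\mathfrak{sp}^H$ is isomorphic to it as a real Lie algebra. -/

import Mathlib

open scoped Manifold ContDiff Topology Bundle
open VectorField Set Filter

noncomputable section

namespace GermSymm

section Gen

variable {E : Type*} [NormedAddCommGroup E] [NormedSpace ℝ E]
  {B : Type*} [TopologicalSpace B] (I : ModelWithCorners ℝ E B)
  {M : Type*} [TopologicalSpace M] [ChartedSpace B M]

/-! ### Directional derivatives -/

theorem contMDiffAt_dirDeriv [IsManifold I ∞ M] {f : M → ℝ} {X : ∀ x : M, TangentSpace I x} {x : M}
    (hf : ContMDiffAt I 𝓘(ℝ, ℝ) ∞ f x)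
    (hX : ContMDiffAt I I.tangent ∞ (fun y => (X y : TangentBundle I M)) x) :
    ContMDiffAt I 𝓘(ℝ, ℝ) ∞ (fun y => mvfderiv I f y (X y)) x := by
  have : IsManifold I 1 M := IsManifold.of_le (n := ∞) (by simp)
  have h1 := hf.mfderiv_const (m := ∞) (by exact le_rfl)
  have h2 := ContMDiffAt.clm_apply_of_inCoordinates (b₁ := id) (b₂ := f)
    (ϕ := fun m => mfderiv I 𝓘(ℝ, ℝ) f m) (v := X) h1 hX hf
  exact (contMDiff_snd_tangentBundle_modelSpace ℝ 𝓘(ℝ, ℝ)).contMDiffAt.comp x h2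

theorem mvfderiv_comp_extChartAt [IsManifold I ∞ M] [I.Boundaryless] {f : M → ℝ} {g : E → ℝ} {x y : M}
    (hy : y ∈ (extChartAt I x).source) (hfg : f =ᶠ[𝓝 y] g ∘ extChartAt I x)
    (hg : DifferentiableAt ℝ g (extChartAt I x y)) (v : TangentSpace I y) :
    mvfderiv I f y v = fderiv ℝ g (extChartAt I x y) (mfderiv I 𝓘(ℝ, E) (extChartAt I x) y v) := by
  have : IsManifold I 1 M := IsManifold.of_le (n := ∞) (by simp)
  have h : mfderiv I 𝓘(ℝ, ℝ) f y = (mfderiv 𝓘(ℝ, E) 𝓘(ℝ, ℝ) g (extChartAt I x y)).comp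
      (mfderiv I 𝓘(ℝ, E) (extChartAt I x) y) := by
    rw [← mfderiv_comp y hg.mdifferentiableAt
      (mdifferentiableAt_extChartAt (by simpa using hy))]
    exact hfg.mfderiv_eq
  rw [mfderiv_eq_fderiv] at h
  simp only [mvfderiv]
  exact congrArg (fun T => T v) h

theorem dirDeriv_mlieBracket [IsManifold I ∞ M] [I.Boundaryless] [CompleteSpace E]
    {f : M → ℝ} {X Y : ∀ x : M, TangentSpace I x} {x : M}
    (hf : ContMDiffAt I 𝓘(ℝ, ℝ) 2 f x)
    (hX : ContMDiffAt I I.tangent 1 (fun y => (X y : TangentBundle I M)) x)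
    (hY : ContMDiffAt I I.tangent 1 (fun y => (Y y : TangentBundle I M)) x) :
    mvfderiv I f x (mlieBracket I X Y x) =
      mvfderiv I (fun y => mvfderiv I f y (Y y)) x (X x) -
        mvfderiv I (fun y => mvfderiv I f y (X y)) x (Y x) := by
  have : IsManifold I 1 M := IsManifold.of_le (n := ∞) (by simp)
  have : IsManifold I 2 M := IsManifold.of_le (n := ∞) (by norm_cast)
  set φ := extChartAt I x with hφ
  set g : E → ℝ := f ∘ φ.symm with hgdef
  let X' : E → E := mpullbackWithin 𝓘(ℝ, E) I φ.symm X (range I)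
  let Y' : E → E := mpullbackWithin 𝓘(ℝ, E) I φ.symm Y (range I)
  have hsrc : ∀ᶠ y in 𝓝 x, y ∈ φ.source := extChartAt_source_mem_nhds x
  have hg : ContDiffAt ℝ 2 g (φ x) := by
    have := (contMDiffAt_iff.1 hf).2
    rw [I.range_eq_univ, contDiffWithinAt_univ] at this
    exact this
  have key : ∀ (Z : ∀ x : M, TangentSpace I x), ∀ᶠ y in 𝓝 x,
      mfderiv I 𝓘(ℝ, E) φ y (Z y) = mpullbackWithin 𝓘(ℝ, E) I φ.symm Z (range I) (φ y) := by
    intro Z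
    have h := eventuallyEq_mpullback_mpullbackWithin_extChartAt (s := univ) (x := x) (I := I) Z
    rw [nhdsWithin_univ] at h
    filter_upwards [h, hsrc] with y hy hys
    rw [hy, mpullback_apply]
    exact (isInvertible_mfderiv_extChartAt hys).self_apply_inverse _
  have hfg : ∀ y ∈ φ.source, f =ᶠ[𝓝 y] g ∘ φ := by
    intro y hy
    filter_upwards [(isOpen_extChartAt_source x).mem_nhds hy] with z hz
    simp [hgdef, φ.left_inv hz]
  have hgd : ∀ᶠ y in 𝓝 x, DifferentiableAt ℝ g (φ y) := by
    have h1 : ∀ᶠ e in 𝓝 (φ x), ContDiffAt ℝ 2 g e := hg.eventually (by simp)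
    filter_upwards [(continuousAt_extChartAt x).eventually h1] with y hy
    exact hy.differentiableAt (by simp)
  have hdir : ∀ (Z : ∀ x : M, TangentSpace I x),
      (fun y => mvfderiv I f y (Z y)) =ᶠ[𝓝 x]
        (fun e => fderiv ℝ g e (mpullbackWithin 𝓘(ℝ, E) I φ.symm Z (range I) e)) ∘ φ := by
    intro Z
    filter_upwards [hsrc, hgd, key Z] with y hy hgy hk
    rw [mvfderiv_comp_extChartAt I hy (hfg y hy) hgy, hk]
    rfl
  have hset : φ.symm ⁻¹' univ ∩ range I = univ := by simp [I.range_eq_univ]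
  have hX' : DifferentiableAt ℝ X' (φ x) := by
    have h : DifferentiableWithinAt ℝ X' (φ.symm ⁻¹' univ ∩ range I) (φ x) :=
      (mdifferentiableWithinAt_univ.2 (hX.mdifferentiableAt
        one_ne_zero)).differentiableWithinAt_mpullbackWithin_vectorField
    rwa [hset, differentiableWithinAt_univ] at h
  have hY' : DifferentiableAt ℝ Y' (φ x) := by
    have h : DifferentiableWithinAt ℝ Y' (φ.symm ⁻¹' univ ∩ range I) (φ x) :=
      (mdifferentiableWithinAt_univ.2 (hY.mdifferentiableAt
        one_ne_zero)).differentiableWithinAt_mpullbackWithin_vectorField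
    rwa [hset, differentiableWithinAt_univ] at h
  have hdg : DifferentiableAt ℝ (fderiv ℝ g) (φ x) :=
    (hg.fderiv_right (m := 1) (by norm_num)).differentiableAt (by simp)
  have hx : x ∈ φ.source := mem_extChartAt_source x
  have hbr : mfderiv I 𝓘(ℝ, E) φ x (mlieBracket I X Y x) = lieBracket ℝ X' Y' (φ x) := by
    rw [← mlieBracketWithin_univ, mlieBracketWithin_apply]
    refine ((isInvertible_mfderiv_extChartAt hx).self_apply_inverse _).trans ?_
    change lieBracketWithin ℝ X' Y' (φ.symm ⁻¹' univ ∩ range I) (φ x) = _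
    rw [hset, lieBracketWithin_univ]
  rw [mvfderiv_comp_extChartAt I hx (hfg x hx) hgd.self_of_nhds, hbr,
    mvfderiv_comp_extChartAt I hx (hdir Y) (hdg.clm_apply hY'),
    mvfderiv_comp_extChartAt I hx (hdir X) (hdg.clm_apply hX'), (key X).self_of_nhds, (key Y).self_of_nhds]
  exact fderiv_apply_lieBracket hg (by simp) hY' hX'

/-! ### Germs of smooth functions -/

/-- Real functions on `M` that are smooth on some neighbourhood of `u`. -/
def smoothNear (u : M) : Subalgebra ℝ (M → ℝ) where
  carrier := {f | ∀ᶠ x in 𝓝 u, ContMDiffAt I 𝓘(ℝ, ℝ) ∞ f x}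
  mul_mem' hf hg := by filter_upwards [hf, hg] with x h1 h2 using h1.mul h2
  add_mem' hf hg := by filter_upwards [hf, hg] with x h1 h2 using h1.add h2
  algebraMap_mem' r := Eventually.of_forall fun _ => contMDiffAt_const

/-- Those that vanish on some neighbourhood of `u`. -/
def nullNear (u : M) : Ideal (smoothNear I u) where
  carrier := {f | ∀ᶠ x in 𝓝 u, f.1 x = 0}
  add_mem' {f g} hf hg := by
    filter_upwards [hf, hg] with x h1 h2
    change f.1 x + g.1 x = 0
    rw [h1, h2, add_zero]
  zero_mem' := Eventually.of_forall fun _ => rfl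
  smul_mem' c f hf := by
    filter_upwards [hf] with x h1
    change c.1 x * f.1 x = 0
    rw [h1, mul_zero]

/-- The algebra of germs at `u` of smooth real functions. -/
def FunGerm (u : M) : Type _ := smoothNear I u ⧸ nullNear I u

instance (u : M) : CommRing (FunGerm I u) :=
  inferInstanceAs (CommRing (smoothNear I u ⧸ nullNear I u))

instance (u : M) : Algebra ℝ (FunGerm I u) :=
  inferInstanceAs (Algebra ℝ (smoothNear I u ⧸ nullNear I u))

/-- The germ at `u` of a function which is smooth near `u`. -/
def FunGerm.mk (u : M) : smoothNear I u →ₐ[ℝ] FunGerm I u :=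
  Ideal.Quotient.mkₐ ℝ (nullNear I u)

theorem FunGerm.mk_surjective (u : M) : Function.Surjective (FunGerm.mk I u) :=
  Ideal.Quotient.mk_surjective

theorem FunGerm.mk_eq_iff {u : M} {f g : smoothNear I u} :
    FunGerm.mk I u f = FunGerm.mk I u g ↔ ∀ᶠ x in 𝓝 u, f.1 x = g.1 x := by
  refine Ideal.Quotient.eq.trans ?_
  refine eventually_congr (Eventually.of_forall fun x => ?_)
  change f.1 x - g.1 x = 0 ↔ _
  exact sub_eq_zero

/-! ### Germs of smooth vector fields -/

variable [IsManifold I ∞ M]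

/-- A vector field is smooth at every point near `u`. -/
def SmoothVFNear (u : M) (X : ∀ x : M, TangentSpace I x) : Prop :=
  ∀ᶠ x in 𝓝 u, ContMDiffAt I I.tangent ∞ (fun y => (X y : TangentBundle I M)) x

/-- Vector fields on `M` that are smooth on some neighbourhood of `u`. -/
def vfNear (u : M) : Submodule ℝ (∀ x : M, TangentSpace I x) where
  carrier := {X | SmoothVFNear I u X}
  add_mem' hX hY := by filter_upwards [hX, hY] with x h1 h2 using h1.add_section h2
  zero_mem' := Eventually.of_forall fun _ => (Bundle.contMDiff_zeroSection ℝ (TangentSpace I)).contMDiffAt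
  smul_mem' c X hX := by filter_upwards [hX] with x h1 using h1.const_smul_section

/-- Those that vanish on some neighbourhood of `u`. -/
def nullVFNear (u : M) : Submodule ℝ (vfNear I u) where
  carrier := {X | ∀ᶠ x in 𝓝 u, X.1 x = 0}
  add_mem' {X Y} hX hY := by
    filter_upwards [hX, hY] with x h1 h2
    change X.1 x + Y.1 x = 0
    rw [h1, h2, add_zero]
  zero_mem' := Eventually.of_forall fun _ => rfl
  smul_mem' c X hX := by
    filter_upwards [hX] with x h1
    change c • X.1 x = 0
    rw [h1, smul_zero]

/-- The space of germs at `u` of smooth vector fields on `M`. -/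
def VFGerm (u : M) : Type _ := vfNear I u ⧸ nullVFNear I u

instance (u : M) : AddCommGroup (VFGerm I u) :=
  inferInstanceAs (AddCommGroup (vfNear I u ⧸ nullVFNear I u))

instance (u : M) : Module ℝ (VFGerm I u) :=
  inferInstanceAs (Module ℝ (vfNear I u ⧸ nullVFNear I u))

/-- The germ at `u` of a vector field which is smooth near `u`. -/
def VFGerm.mk (u : M) : vfNear I u →ₗ[ℝ] VFGerm I u := (nullVFNear I u).mkQ

theorem VFGerm.mk_surjective (u : M) : Function.Surjective (VFGerm.mk I u) :=
  (nullVFNear I u).mkQ_surjective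

theorem VFGerm.mk_eq_iff {u : M} {X Y : vfNear I u} :
    VFGerm.mk I u X = VFGerm.mk I u Y ↔ ∀ᶠ x in 𝓝 u, X.1 x = Y.1 x := by
  refine (Submodule.Quotient.eq _).trans ?_
  refine eventually_congr (Eventually.of_forall fun x => ?_)
  change X.1 x - Y.1 x = 0 ↔ _
  exact sub_eq_zero

/-! ### The action of vector fields on functions -/

/-- The derivative `X f = df(X)`, near `u`. -/
def derivRep {u : M} (X : vfNear I u) (f : smoothNear I u) : smoothNear I u :=
  ⟨fun x => mvfderiv I f.1 x (X.1 x), by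
    filter_upwards [X.2, f.2] with x hX hf using contMDiffAt_dirDeriv I hf hX⟩

instance (u : M) : Bracket (VFGerm I u) (FunGerm I u) where
  bracket := Quotient.map₂ (sa := (nullVFNear I u).quotientRel) (sb := (nullNear I u).quotientRel)
    (sc := (nullNear I u).quotientRel) (derivRep I) (by
      intro X Y hXY f g hfg
      have h1 := (VFGerm.mk_eq_iff I).1 (Quotient.sound hXY)
      have h2 := (FunGerm.mk_eq_iff I).1 (Quotient.sound hfg)
      refine Quotient.exact ((FunGerm.mk_eq_iff I).2 ?_)
      filter_upwards [h1, h2.eventually_nhds] with x hx hf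
      have hf' : f.1 =ᶠ[𝓝 x] g.1 := hf
      change mvfderiv I f.1 x (X.1 x) = mvfderiv I g.1 x (Y.1 x)
      rw [hx]
      simp only [mvfderiv, hf'.mfderiv_eq]
      rfl)

theorem bracket_mk_fun {u : M} (X : vfNear I u) (f : smoothNear I u) :
    ⁅VFGerm.mk I u X, FunGerm.mk I u f⁆ = FunGerm.mk I u (derivRep I X f) := rfl

/-! ### The Lie algebra of germs of vector fields -/

variable [I.Boundaryless] [CompleteSpace E]

/-- The Lie bracket `[X, Y]`, near `u`. -/
def bracketRep {u : M} (X Y : vfNear I u) : vfNear I u :=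
  ⟨mlieBracket I X.1 Y.1, by
    have hX : SmoothVFNear I u X.1 := X.2
    have hY : SmoothVFNear I u Y.1 := Y.2
    have : IsManifold I (((⊤ : ℕ∞) : WithTop ℕ∞) + 1) M := inferInstanceAs (IsManifold I ∞ M)
    have : IsManifold I (minSmoothness ℝ 2) M :=
      IsManifold.of_le (n := ∞) (by simp; norm_cast)
    change SmoothVFNear I u _
    filter_upwards [hX, hY] with x h1 h2
    exact ContMDiffAt.mlieBracket_vectorField (m := ⊤) (n := ⊤) h1 h2 (by simp)⟩

instance (u : M) : Bracket (VFGerm I u) (VFGerm I u) where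
  bracket := Quotient.map₂ (sa := (nullVFNear I u).quotientRel)
    (sb := (nullVFNear I u).quotientRel) (sc := (nullVFNear I u).quotientRel) (bracketRep I) (by
      intro X Y hXY Z W hZW
      have h1 := (VFGerm.mk_eq_iff I).1 (Quotient.sound hXY)
      have h2 := (VFGerm.mk_eq_iff I).1 (Quotient.sound hZW)
      refine Quotient.exact ((VFGerm.mk_eq_iff I).2 ?_)
      exact EventuallyEq.mlieBracket_vectorField h1 h2)

theorem bracket_mk_vf {u : M} (X Y : vfNear I u) :
    ⁅VFGerm.mk I u X, VFGerm.mk I u Y⁆ = VFGerm.mk I u (bracketRep I X Y) := rfl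

theorem SmoothVFNear.mdiff {u : M} {X : ∀ x : M, TangentSpace I x} (hX : SmoothVFNear I u X) :
    ∀ᶠ x in 𝓝 u, MDifferentiableAt I I.tangent (fun y => (X y : TangentBundle I M)) x := by
  filter_upwards [hX] with x h using h.mdifferentiableAt (by simp)

instance (u : M) : LieRing (VFGerm I u) where
  add_lie X Y Z := by
    obtain ⟨X, rfl⟩ := VFGerm.mk_surjective I u X
    obtain ⟨Y, rfl⟩ := VFGerm.mk_surjective I u Y
    obtain ⟨Z, rfl⟩ := VFGerm.mk_surjective I u Z
    have : IsManifold I 2 M := IsManifold.of_le (n := ∞) (by norm_cast)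
    rw [← map_add, bracket_mk_vf, bracket_mk_vf, bracket_mk_vf, ← map_add, VFGerm.mk_eq_iff]
    filter_upwards [SmoothVFNear.mdiff I X.2, SmoothVFNear.mdiff I Y.2] with x hX hY
    exact mlieBracket_add_left hX hY
  lie_add X Y Z := by
    obtain ⟨X, rfl⟩ := VFGerm.mk_surjective I u X
    obtain ⟨Y, rfl⟩ := VFGerm.mk_surjective I u Y
    obtain ⟨Z, rfl⟩ := VFGerm.mk_surjective I u Z
    have : IsManifold I 2 M := IsManifold.of_le (n := ∞) (by norm_cast)
    rw [← map_add, bracket_mk_vf, bracket_mk_vf, bracket_mk_vf, ← map_add, VFGerm.mk_eq_iff]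
    filter_upwards [SmoothVFNear.mdiff I Y.2, SmoothVFNear.mdiff I Z.2] with x hX hY
    exact mlieBracket_add_right hX hY
  lie_self X := by
    obtain ⟨X, rfl⟩ := VFGerm.mk_surjective I u X
    rw [bracket_mk_vf, ← map_zero (VFGerm.mk I u), VFGerm.mk_eq_iff]
    exact Eventually.of_forall fun x => congrFun mlieBracket_self x
  leibniz_lie X Y Z := by
    obtain ⟨X, rfl⟩ := VFGerm.mk_surjective I u X
    obtain ⟨Y, rfl⟩ := VFGerm.mk_surjective I u Y
    obtain ⟨Z, rfl⟩ := VFGerm.mk_surjective I u Z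
    have : IsManifold I (minSmoothness ℝ 3) M :=
      IsManifold.of_le (n := ∞) (by simp; norm_cast)
    simp only [bracket_mk_vf]
    rw [← map_add, VFGerm.mk_eq_iff]
    have hX : SmoothVFNear I u X.1 := X.2
    have hY : SmoothVFNear I u Y.1 := Y.2
    have hZ : SmoothVFNear I u Z.1 := Z.2
    filter_upwards [hX, hY, hZ] with x h1 h2 h3
    have h : minSmoothness ℝ 2 ≤ ∞ := by simp; norm_cast
    exact leibniz_identity_mlieBracket_apply (h1.of_le h) (h2.of_le h) (h3.of_le h)

instance (u : M) : LieAlgebra ℝ (VFGerm I u) where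
  lie_smul t X Y := by
    obtain ⟨X, rfl⟩ := VFGerm.mk_surjective I u X
    obtain ⟨Y, rfl⟩ := VFGerm.mk_surjective I u Y
    have : IsManifold I 2 M := IsManifold.of_le (n := ∞) (by norm_cast)
    rw [← map_smul, bracket_mk_vf, bracket_mk_vf, ← map_smul, VFGerm.mk_eq_iff]
    filter_upwards [SmoothVFNear.mdiff I Y.2] with x hY
    exact mlieBracket_const_smul_right hY

theorem smoothNear_mdiff {u : M} (f : smoothNear I u) :
    ∀ᶠ x in 𝓝 u, MDifferentiableAt I 𝓘(ℝ, ℝ) f.1 x := by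
  have h : ∀ᶠ x in 𝓝 u, ContMDiffAt I 𝓘(ℝ, ℝ) ∞ f.1 x := f.2
  filter_upwards [h] with x h using h.mdifferentiableAt (by simp)

instance (u : M) : LieRingModule (VFGerm I u) (FunGerm I u) where
  add_lie X Y f := by
    obtain ⟨X, rfl⟩ := VFGerm.mk_surjective I u X
    obtain ⟨Y, rfl⟩ := VFGerm.mk_surjective I u Y
    obtain ⟨f, rfl⟩ := FunGerm.mk_surjective I u f
    rw [← map_add, bracket_mk_fun, bracket_mk_fun, bracket_mk_fun, ← map_add, FunGerm.mk_eq_iff]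
    exact Eventually.of_forall fun x => map_add (mvfderiv I f.1 x) (X.1 x) (Y.1 x)
  lie_add X f g := by
    obtain ⟨X, rfl⟩ := VFGerm.mk_surjective I u X
    obtain ⟨f, rfl⟩ := FunGerm.mk_surjective I u f
    obtain ⟨g, rfl⟩ := FunGerm.mk_surjective I u g
    rw [← map_add, bracket_mk_fun, bracket_mk_fun, bracket_mk_fun, ← map_add, FunGerm.mk_eq_iff]
    filter_upwards [smoothNear_mdiff I f, smoothNear_mdiff I g] with x hf hg
    exact congrArg (fun T => T (X.1 x)) (mvfderiv_add hf hg)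
  leibniz_lie X Y f := by
    obtain ⟨X, rfl⟩ := VFGerm.mk_surjective I u X
    obtain ⟨Y, rfl⟩ := VFGerm.mk_surjective I u Y
    obtain ⟨f, rfl⟩ := FunGerm.mk_surjective I u f
    simp only [bracket_mk_fun, bracket_mk_vf]
    rw [← map_add, FunGerm.mk_eq_iff]
    have hX : SmoothVFNear I u X.1 := X.2
    have hY : SmoothVFNear I u Y.1 := Y.2
    have hf : ∀ᶠ x in 𝓝 u, ContMDiffAt I 𝓘(ℝ, ℝ) ∞ f.1 x := f.2
    filter_upwards [hX, hY, hf] with x h1 h2 h3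
    have := dirDeriv_mlieBracket I (h3.of_le (by norm_cast)) (h1.of_le (by simp))
      (h2.of_le (by simp))
    exact (sub_eq_iff_eq_add.1 this.symm)

instance (u : M) : LieModule ℝ (VFGerm I u) (FunGerm I u) where
  smul_lie t X f := by
    obtain ⟨X, rfl⟩ := VFGerm.mk_surjective I u X
    obtain ⟨f, rfl⟩ := FunGerm.mk_surjective I u f
    rw [← map_smul, bracket_mk_fun, bracket_mk_fun, ← map_smul, FunGerm.mk_eq_iff]
    exact Eventually.of_forall fun x => map_smul (mvfderiv I f.1 x) t (X.1 x)
  lie_smul t X f := by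
    obtain ⟨X, rfl⟩ := VFGerm.mk_surjective I u X
    obtain ⟨f, rfl⟩ := FunGerm.mk_surjective I u f
    rw [← map_smul, bracket_mk_fun, bracket_mk_fun, ← map_smul, FunGerm.mk_eq_iff]
    filter_upwards [smoothNear_mdiff I f] with x hf
    have h := congrArg (fun T => T (X.1 x))
      (mvfderiv_smul (mdifferentiableAt_const (c := t)) hf)
    rw [mvfderiv_const] at h
    simp only [ContinuousLinearMap.zero_smulRight, add_zero] at h
    exact h

/-! ### Differential forms -/

/-- Germs at `u` of 1-forms on `M`, recorded as the maps they induce on germs of vector fields. -/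
abbrev OneForm (u : M) : Type _ := VFGerm I u →ₗ[ℝ] FunGerm I u

/-- Germs at `u` of 2-forms on `M`, recorded as the maps they induce on germs of vector fields. -/
abbrev TwoForm (u : M) : Type _ := VFGerm I u →ₗ[ℝ] VFGerm I u →ₗ[ℝ] FunGerm I u

/-- The germ at `u` of a pointwise given 1-form `α` whose contraction with every vector field
smooth near `u` is smooth near `u`. -/
def OneForm.ofPointwise {u : M} (α : ∀ x : M, TangentSpace I x →L[ℝ] ℝ)
    (hα : ∀ V ∈ vfNear I u, (fun x => α x (V x)) ∈ smoothNear I u) : OneForm I u where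
  toFun := Quotient.map' (s₁ := (nullVFNear I u).quotientRel) (s₂ := (nullNear I u).quotientRel)
    (fun V => ⟨fun x => α x (V.1 x), hα V.1 V.2⟩) (by
      intro V W hVW
      have h1 := (VFGerm.mk_eq_iff I).1 (Quotient.sound hVW)
      refine Quotient.exact ((FunGerm.mk_eq_iff I).2 ?_)
      filter_upwards [h1] with x hx
      change α x (V.1 x) = α x (W.1 x)
      rw [hx])
  map_add' V W := by
    obtain ⟨V, rfl⟩ := VFGerm.mk_surjective I u V
    obtain ⟨W, rfl⟩ := VFGerm.mk_surjective I u W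
    exact (FunGerm.mk_eq_iff I).2 (Eventually.of_forall fun x => map_add (α x) (V.1 x) (W.1 x))
  map_smul' t V := by
    obtain ⟨V, rfl⟩ := VFGerm.mk_surjective I u V
    exact (FunGerm.mk_eq_iff I).2 (Eventually.of_forall fun x => map_smul (α x) t (V.1 x))

/-- The differential of a function, `df(X) = X f`. -/
def dFun {u : M} (f : FunGerm I u) : OneForm I u where
  toFun X := ⁅X, f⁆
  map_add' X Y := add_lie X Y f
  map_smul' t X := smul_lie t X f

/-- The wedge product, `(α ∧ β)(X, Y) = α(X) β(Y) - α(Y) β(X)`. -/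
def wedge {u : M} (α β : OneForm I u) : TwoForm I u :=
  LinearMap.mk₂ ℝ (fun X Y => α X * β Y - α Y * β X)
    (by intros; simp; ring) (by intros; simp [smul_sub])
    (by intros; simp; ring) (by intros; simp [smul_sub])

/-- The exterior derivative of a 1-form, `dα(X, Y) = X (α Y) - Y (α X) - α [X, Y]`. -/
def extD {u : M} (α : OneForm I u) : TwoForm I u :=
  LinearMap.mk₂ ℝ (fun X Y => ⁅X, α Y⁆ - ⁅Y, α X⁆ - α ⁅X, Y⁆)
    (by intros; simp; abel) (by intros; simp [smul_sub])
    (by intros; simp; abel) (by intros; simp [smul_sub])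

/-- The Lie derivative of a 2-form,
`(L_Y η)(V, W) = Y (η(V, W)) - η([Y, V], W) - η(V, [Y, W])`. -/
def lieD {u : M} (Y : VFGerm I u) (η : TwoForm I u) : TwoForm I u :=
  LinearMap.mk₂ ℝ (fun V W => ⁅Y, η V W⁆ - η ⁅Y, V⁆ W - η V ⁅Y, W⁆)
    (by intros; simp; abel) (by intros; simp [smul_sub])
    (by intros; simp; abel) (by intros; simp [smul_sub])

theorem lieD_eq_zero_iff {u : M} {Y : VFGerm I u} {η : TwoForm I u} :
    lieD I Y η = 0 ↔ ∀ V W, ⁅Y, η V W⁆ = η ⁅Y, V⁆ W + η V ⁅Y, W⁆ := by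
  refine LinearMap.ext_iff₂.trans (forall₂_congr fun V W => ?_)
  change ⁅Y, η V W⁆ - η ⁅Y, V⁆ W - η V ⁅Y, W⁆ = 0 ↔ _
  rw [sub_sub, sub_eq_zero]

/-! ### Subalgebras of germs of vector fields -/

/-- The germs `Y` with `L_Y η = 0`. -/
def preserving {u : M} (η : TwoForm I u) : LieSubalgebra ℝ (VFGerm I u) where
  carrier := {Y | lieD I Y η = 0}
  add_mem' {Y Z} hY hZ := by
    simp only [mem_ofPred_eq, lieD_eq_zero_iff] at *
    intro V W
    simp only [add_lie, map_add, LinearMap.add_apply, hY, hZ]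
    abel
  zero_mem' := by
    simp only [mem_ofPred_eq, lieD_eq_zero_iff]
    intro V W
    simp
  smul_mem' t Y hY := by
    simp only [mem_ofPred_eq, lieD_eq_zero_iff] at *
    intro V W
    simp only [smul_lie, map_smul, LinearMap.smul_apply, hY, smul_add]
  lie_mem' {Y Z} hY hZ := by
    have hY' := (lieD_eq_zero_iff I).1 hY
    have hZ' := (lieD_eq_zero_iff I).1 hZ
    refine (lieD_eq_zero_iff I).2 fun V W => ?_
    simp only [lie_lie, hY', hZ', lie_add, map_sub, LinearMap.sub_apply]
    abel

/-- The germs `Y` with `ι_Y df = 0`. -/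
def annihilating {u : M} (f : FunGerm I u) : LieSubalgebra ℝ (VFGerm I u) where
  carrier := {Y | dFun I f Y = 0}
  add_mem' {Y Z} hY hZ := by
    simp only [mem_ofPred_eq] at *
    rw [map_add, hY, hZ, add_zero]
  zero_mem' := map_zero _
  smul_mem' t Y hY := by
    simp only [mem_ofPred_eq] at *
    rw [map_smul, hY, smul_zero]
  lie_mem' {Y Z} hY hZ := by
    have hY' : ⁅Y, f⁆ = 0 := hY
    have hZ' : ⁅Z, f⁆ = 0 := hZ
    change ⁅⁅Y, Z⁆, f⁆ = 0
    rw [lie_lie, hY', hZ', lie_zero, lie_zero, sub_zero]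

/-- The germs `Y` with `L_Z Y = [Z, Y] = 0`. -/
def commutingWith {u : M} (Z : VFGerm I u) : LieSubalgebra ℝ (VFGerm I u) where
  carrier := {Y | ⁅Z, Y⁆ = 0}
  add_mem' {X Y} hX hY := by
    simp only [mem_ofPred_eq] at *
    rw [lie_add, hX, hY, add_zero]
  zero_mem' := lie_zero _
  smul_mem' t Y hY := by
    simp only [mem_ofPred_eq] at *
    rw [lie_smul, hY, smul_zero]
  lie_mem' {X Y} hX hY := by
    have hX' : ⁅Z, X⁆ = 0 := hX
    have hY' : ⁅Z, Y⁆ = 0 := hY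
    change ⁅Z, ⁅X, Y⁆⁆ = 0
    rw [leibniz_lie, hX', hY', zero_lie, lie_zero, add_zero]

end Gen

/-! ### The cotangent bundle and `H`-symplectic symmetries -/

section Cotangent

variable (n : ℕ) (N : Type*) [TopologicalSpace N] [ChartedSpace (EuclideanSpace ℝ (Fin n)) N]
  [IsManifold (𝓡 n) ∞ N]

/-- The cotangent bundle `T*N` of an `n`-dimensional manifold `N`, with the topology and smooth
structure of the bundle of linear forms on the tangent spaces. -/
abbrev CotangentBundle : Type _ :=
  Bundle.TotalSpace (EuclideanSpace ℝ (Fin n) →L[ℝ] ℝ)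
    (fun x : N => TangentSpace (𝓡 n) x →L[ℝ] ℝ)

/-- The model with corners of `T*N`. -/
abbrev cotangentModel :=
  (𝓡 n).prod 𝓘(ℝ, EuclideanSpace ℝ (Fin n) →L[ℝ] ℝ)

/-- The tautological 1-form `ϑ_β(v) = β(dπ(v))` of `T*N`, where `π : T*N → N`. -/
def tautological (β : CotangentBundle n N) : TangentSpace (cotangentModel n) β →L[ℝ] ℝ :=
  β.snd.comp (mfderiv (cotangentModel n) (𝓡 n) (fun γ : CotangentBundle n N => γ.proj) β)

theorem contMDiffAt_tautological {V : ∀ β : CotangentBundle n N, TangentSpace (cotangentModel n) β}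
    {β : CotangentBundle n N}
    (hV : ContMDiffAt (cotangentModel n) (cotangentModel n).tangent ∞
      (fun γ => (V γ : TangentBundle (cotangentModel n) (CotangentBundle n N))) β) :
    ContMDiffAt (cotangentModel n) 𝓘(ℝ, ℝ) ∞ (fun γ => tautological n N γ (V γ)) β := by
  have hπ : ContMDiff (cotangentModel n) (𝓡 n) ∞ (fun γ : CotangentBundle n N => γ.proj) :=
    Bundle.contMDiff_proj _
  have h1 := (hπ.contMDiff_tangentMap (m := ∞) le_rfl).contMDiffAt.comp β hV
  have h2 : ContMDiffAt (cotangentModel n) (cotangentModel n) ∞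
      (fun γ : CotangentBundle n N => γ) β := contMDiffAt_id
  have h3 := ContMDiffAt.clm_bundle_apply (n := ∞) (F₁ := EuclideanSpace ℝ (Fin n))
    (E₁ := fun x : N => TangentSpace (𝓡 n) x) (F₂ := ℝ) (E₂ := Bundle.Trivial N ℝ)
    (IB := 𝓡 n) (IM := cotangentModel n)
    (b := fun γ : CotangentBundle n N => γ.proj) (ϕ := fun γ => γ.snd)
    (v := fun γ => mfderiv (cotangentModel n) (𝓡 n)
      (fun γ : CotangentBundle n N => γ.proj) γ (V γ)) h2 h1
  exact (Bundle.contMDiffAt_totalSpace.1 h3).2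

/-- The canonical symplectic form `Ω = dϑ` of `T*N`, as a germ at `u`. -/
def canonicalForm (u : CotangentBundle n N) : TwoForm (cotangentModel n) u :=
  extD (cotangentModel n) (OneForm.ofPointwise (cotangentModel n) (tautological n N) (by
    intro V hV
    have hV' : SmoothVFNear (cotangentModel n) u V := hV
    change ∀ᶠ x in 𝓝 u, _
    filter_upwards [hV'] with β hβ using contMDiffAt_tautological n N hβ))

/-- The Lie algebra of germs at `u` of `H`-symplectic symmetries of `T*N`: the germs `Y` with
`L_Y Ω = 0` and `ι_Y dH = 0`. -/
def spH {u : CotangentBundle n N} (H : FunGerm (cotangentModel n) u) :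
    LieSubalgebra ℝ (VFGerm (cotangentModel n) u) :=
  preserving (cotangentModel n) (canonicalForm n N u) ⊓ annihilating (cotangentModel n) H

end Cotangent

/-! ### The model algebra on `ℝ²ⁿ` -/

section Model

variable (n : ℕ)

/-- The germ at `0` of the `i`-th coordinate function of `ℝᵐ` (counted from `0`). -/
def coordGerm {m : ℕ} (i : Fin m) : FunGerm (𝓡 m) (0 : EuclideanSpace ℝ (Fin m)) :=
  FunGerm.mk (𝓡 m) 0 ⟨fun x => x i, by
    refine Eventually.of_forall fun x => ContDiffAt.contMDiffAt ?_
    fun_prop⟩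

/-- The germ at `0` of the `i`-th coordinate vector field of `ℝᵐ` (counted from `0`). -/
def coordVF {m : ℕ} (i : Fin m) : VFGerm (𝓡 m) (0 : EuclideanSpace ℝ (Fin m)) :=
  VFGerm.mk (𝓡 m) 0 ⟨fun _ => EuclideanSpace.single i (1 : ℝ), by
    refine Eventually.of_forall fun x => ?_
    exact contMDiffAt_vectorSpace_iff_contDiffAt.2 contDiffAt_const⟩

/-- The index of the coordinate `x^{2i+1}` of `ℝ²ⁿ`, for `0 ≤ i < n`. -/
def oddIdx {n : ℕ} (i : Fin n) : Fin (2 * n) := ⟨2 * i, by omega⟩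

/-- The index of the coordinate `x^{2i+2}` of `ℝ²ⁿ`, for `0 ≤ i < n`. -/
def evenIdx {n : ℕ} (i : Fin n) : Fin (2 * n) := ⟨2 * i + 1, by omega⟩

/-- The standard symplectic form `dx^1 ∧ dx^2 + ⋯ + dx^{2n-1} ∧ dx^{2n}` of `ℝ²ⁿ`, as a germ
at `0`. -/
def stdForm : TwoForm (𝓡 (2 * n)) (0 : EuclideanSpace ℝ (Fin (2 * n))) :=
  ∑ i : Fin n, wedge (𝓡 (2 * n)) (dFun (𝓡 (2 * n)) (coordGerm (oddIdx i)))
    (dFun (𝓡 (2 * n)) (coordGerm (evenIdx i)))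

/-- The Lie algebra of germs at `0` of vector fields of `ℝ²ⁿ` preserving the standard form. -/
def spInfty : LieSubalgebra ℝ (VFGerm (𝓡 (2 * n)) (0 : EuclideanSpace ℝ (Fin (2 * n)))) :=
  preserving (𝓡 (2 * n)) (stdForm n)

/-- The subalgebra of those `X` that commute with `∂/∂x^1` and have no `∂/∂x^2`-component,
`dx^2(X) = 0`. -/
def spInftyOne (hn : 0 < n) :
    LieSubalgebra ℝ (VFGerm (𝓡 (2 * n)) (0 : EuclideanSpace ℝ (Fin (2 * n)))) :=
  spInfty n ⊓ commutingWith (𝓡 (2 * n)) (coordVF (oddIdx ⟨0, hn⟩)) ⊓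
    annihilating (𝓡 (2 * n)) (coordGerm (evenIdx ⟨0, hn⟩))

end Model

theorem mem_smoothNear_of_contMDiffOn {E : Type*} [NormedAddCommGroup E] [NormedSpace ℝ E]
    {B : Type*} [TopologicalSpace B] {I : ModelWithCorners ℝ E B}
    {M : Type*} [TopologicalSpace M] [ChartedSpace B M] {U : Set M} (hU : IsOpen U) {H : M → ℝ}
    (hH : ContMDiffOn I 𝓘(ℝ, ℝ) ∞ H U) {u : M} (hu : u ∈ U) : H ∈ smoothNear I u := by
  filter_upwards [hU.mem_nhds hu] with x hx using hH.contMDiffAt (hU.mem_nhds hx)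

end GermSymm
end

noncomputable section

namespace GermSymm

/-! ### The inverse function theorem for maps that are smooth near a point -/

theorem exists_smooth_local_inverse {E F : Type*} [NormedAddCommGroup E] [NormedSpace ℝ E]
    [CompleteSpace E] [NormedAddCommGroup F] [NormedSpace ℝ F] {f : E → F} {a : E} (f' : E ≃L[ℝ] F)
    (hf : ∀ᶠ x in 𝓝 a, ContDiffAt ℝ ∞ f x) (hf' : HasFDerivAt f (f' : E →L[ℝ] F) a) :
    ∃ g : F → E, g (f a) = a ∧ (∀ᶠ y in 𝓝 (f a), ContDiffAt ℝ ∞ g y) ∧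
      (∀ᶠ x in 𝓝 a, g (f x) = x) ∧ ∀ᶠ y in 𝓝 (f a), f (g y) = y := by
  have ha : ContDiffAt ℝ ∞ f a := hf.self_of_nhds
  have h0 : (∞ : WithTop ℕ∞) ≠ 0 := by simp
  set R := ha.toOpenPartialHomeomorph f hf' h0 with hR
  have hRf : ∀ x, R x = f x := fun x => rfl
  have has : a ∈ R.source := ha.mem_toOpenPartialHomeomorph_source hf' h0
  have hat : f a ∈ R.target := ha.image_mem_toOpenPartialHomeomorph_target hf' h0
  have hga : R.symm (f a) = a := R.left_inv has
  refine ⟨R.symm, hga, ?_, R.eventually_left_inverse has, R.eventually_right_inverse hat⟩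
  have hinv : ∀ᶠ x in 𝓝 a, fderiv ℝ f x ∈ range ((↑) : (E ≃L[ℝ] F) → E →L[ℝ] F) := by
    have hc : ContinuousAt (fderiv ℝ f) a :=
      (ha.fderiv_right (m := 0) (by simp)).continuousAt
    refine hc.eventually ?_
    rw [hf'.fderiv]
    exact f'.nhds
  have hsymm : Tendsto R.symm (𝓝 (f a)) (𝓝 a) := by
    have := R.symm.continuousAt hat
    rwa [ContinuousAt, hga] at this
  filter_upwards [hsymm.eventually (hf.and hinv), R.open_target.mem_nhds hat] with y ⟨hy, A, hA⟩ hyt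
  exact R.contDiffAt_symm hyt (f₀' := A) (hA ▸ (hy.differentiableAt h0).hasFDerivAt) hy

/-! ### Smoothness of the composition operator on spaces of continuous maps -/

section Composition

universe u

variable {K : Type*} [TopologicalSpace K] [CompactSpace K]
  {E : Type u} [NormedAddCommGroup E] [NormedSpace ℝ E]

/-- A shortcut instance. -/
instance instNormedAddCommGroupContinuousMapCLM (K : Type*) [TopologicalSpace K] [CompactSpace K]
    (E F : Type*) [NormedAddCommGroup E] [NormedSpace ℝ E] [NormedAddCommGroup F]
    [NormedSpace ℝ F] : NormedAddCommGroup C(K, E →L[ℝ] F) :=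
  ContinuousMap.instNormedAddCommGroup

/-- Pointwise evaluation of a continuous family of continuous linear maps. -/
def evalCLM (K : Type*) [TopologicalSpace K] [CompactSpace K] (E F : Type*)
    [NormedAddCommGroup E] [NormedSpace ℝ E] [NormedAddCommGroup F] [NormedSpace ℝ F] :
    C(K, E →L[ℝ] F) →L[ℝ] C(K, E) →L[ℝ] C(K, F) :=
  LinearMap.mkContinuous₂
    (LinearMap.mk₂ ℝ (fun (A : C(K, E →L[ℝ] F)) (h : C(K, E)) =>
        (⟨fun t => A t (h t), by fun_prop⟩ : C(K, F)))
      (fun _ _ _ => rfl) (fun _ _ _ => rfl)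
      (fun _ _ _ => by ext; simp) (fun _ _ _ => by ext; simp)) 1 (by
    intro A h
    rw [one_mul]
    refine (ContinuousMap.norm_le _ (by positivity)).2 fun t => ?_
    refine ((A t).le_opNorm (h t)).trans ?_
    gcongr
    · exact A.norm_coe_le_norm t
    · exact h.norm_coe_le_norm t)

theorem hasFDerivAt_postcomp {F : Type*} [NormedAddCommGroup F] [NormedSpace ℝ F]
    (f : C(E, F)) (f' : C(E, E →L[ℝ] F)) (hf : ∀ x, HasFDerivAt f (f' x) x) (y : C(K, E)) :
    HasFDerivAt (fun y : C(K, E) => f.comp y) (evalCLM K E F (f'.comp y)) y := by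
  rw [hasFDerivAt_iff_isLittleO, Asymptotics.isLittleO_iff]
  intro ε hε
  have hc : Continuous fun y : C(K, E) => f'.comp y := ContinuousMap.continuous_postcomp f'
  obtain ⟨δ, hδ, hball⟩ := Metric.continuousAt_iff.1 (hc.continuousAt (x := y)) ε hε
  filter_upwards [Metric.ball_mem_nhds y hδ] with z hz
  refine (ContinuousMap.norm_le _ (by positivity)).2 fun t => ?_
  have hseg : ∀ w ∈ segment ℝ (y t) (z t), ‖f' w - f' (y t)‖ ≤ ε := by
    rw [segment_eq_image']
    rintro _ ⟨s, hs, rfl⟩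
    have hmem : dist (y + s • (z - y)) y < δ := by
      rw [dist_eq_norm, add_sub_cancel_left, norm_smul, Real.norm_of_nonneg hs.1]
      have : ‖z - y‖ < δ := by simpa [dist_eq_norm] using hz
      nlinarith [norm_nonneg (z - y), hs.2]
    have h1 := (hball hmem).le
    rw [dist_eq_norm] at h1
    exact (ContinuousMap.norm_coe_le_norm (f'.comp (y + s • (z - y)) - f'.comp y) t).trans h1
  have := (convex_segment (y t) (z t)).norm_image_sub_le_of_norm_hasFDerivWithin_le'
    (fun w _ => (hf w).hasFDerivWithinAt) hseg (left_mem_segment ℝ _ _) (right_mem_segment ℝ _ _)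
  refine this.trans ?_
  gcongr
  exact (z - y).norm_coe_le_norm t

theorem contDiff_nat_postcomp (n : ℕ) {F : Type u} [NormedAddCommGroup F] [NormedSpace ℝ F]
    (f : C(E, F)) (hf : ContDiff ℝ n f) : ContDiff ℝ n (fun y : C(K, E) => f.comp y) := by
  induction n generalizing F with
  | zero => exact contDiff_zero.2 (ContinuousMap.continuous_postcomp f)
  | succ n ih =>
    obtain ⟨f', hf', hd⟩ := contDiff_succ_iff_hasFDerivAt.1 hf
    refine contDiff_succ_iff_hasFDerivAt.2
      ⟨_, ?_, hasFDerivAt_postcomp f ⟨f', hf'.continuous⟩ hd⟩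
    exact (evalCLM K E F).contDiff.comp (ih ⟨f', hf'.continuous⟩ hf')

theorem contDiff_postcomp {F : Type u} [NormedAddCommGroup F] [NormedSpace ℝ F]
    (f : C(E, F)) (hf : ContDiff ℝ ∞ f) : ContDiff ℝ ∞ (fun y : C(K, E) => f.comp y) :=
  contDiff_infty.2 fun n => contDiff_nat_postcomp n f (contDiff_infty.1 hf n)

end Composition

/-! ### Smooth local flows -/

section Flow

variable {E : Type*} [NormedAddCommGroup E] [NormedSpace ℝ E]

/-- The interval on which the rescaled integral curves are defined. -/
abbrev FlowTime : Type := Icc (-1 : ℝ) 1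

/-- The projection of the line to the interval of times. -/
def projTime (r : ℝ) : FlowTime := projIcc (-1) 1 (by norm_num) r

theorem continuous_projTime : Continuous projTime :=
  continuous_projIcc (h := by norm_num)

theorem projTime_coe (r : FlowTime) : projTime r = r := projIcc_val _ r

/-- The primitive that vanishes at time zero. -/
def primitive (E : Type*) [NormedAddCommGroup E] [NormedSpace ℝ E] :
    C(FlowTime, E) →L[ℝ] C(FlowTime, E) :=
  LinearMap.mkContinuous
    { toFun := fun z => ⟨fun r => ∫ q in (0 : ℝ)..r, z (projTime q),
        (intervalIntegral.continuous_primitive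
          (fun a b => (z.continuous.comp continuous_projTime).intervalIntegrable a b) 0).comp
          continuous_subtype_val⟩
      map_add' := fun z w => by
        ext r
        exact intervalIntegral.integral_add
          ((z.continuous.comp continuous_projTime).intervalIntegrable _ _)
          ((w.continuous.comp continuous_projTime).intervalIntegrable _ _)
      map_smul' := fun c z => by
        ext r
        exact intervalIntegral.integral_smul c _ } 1 (by
    intro z
    rw [one_mul]
    refine (ContinuousMap.norm_le _ (norm_nonneg z)).2 fun r => ?_
    refine (intervalIntegral.norm_integral_le_of_norm_le_const
      (C := ‖z‖) fun q _ => z.norm_coe_le_norm _).trans ?_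
    have : |(r : ℝ) - 0| ≤ 1 := by rw [sub_zero]; exact abs_le.2 r.2
    nlinarith [norm_nonneg z])

/-- Multiplication of times by a fixed number in the interval. -/
def scaleTime (s : FlowTime) : C(FlowTime, FlowTime) where
  toFun r := ⟨s * r, by
    have := abs_le.2 s.2
    have h2 := abs_le.2 r.2
    refine abs_le.1 ?_
    rw [abs_mul]
    nlinarith [abs_nonneg (s : ℝ), abs_nonneg (r : ℝ)]⟩
  continuous_toFun := by fun_prop

theorem primitive_comp_scaleTime (z : C(FlowTime, E)) (s : FlowTime) :
    (primitive E z).comp (scaleTime s) = (s : ℝ) • primitive E (z.comp (scaleTime s)) := by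
  ext r
  change ∫ q in (0 : ℝ)..s * r, z (projTime q) =
    (s : ℝ) • ∫ q in (0 : ℝ)..r, z (scaleTime s (projTime q))
  have h := intervalIntegral.smul_integral_comp_mul_left (a := 0) (b := (r : ℝ))
    (fun q => z (projTime q)) (s : ℝ)
  rw [mul_zero] at h
  rw [← h]
  congr 1
  refine intervalIntegral.integral_congr fun q hq => ?_
  have hq' : q ∈ Icc (-1 : ℝ) 1 := by
    have h0 : (0 : ℝ) ∈ Icc (-1 : ℝ) 1 := by norm_num
    exact (uIcc_subset_Icc h0 r.2) hq
  have h1 : projTime q = ⟨q, hq'⟩ := projTime_coe ⟨q, hq'⟩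
  have h2 : projTime (s * q) = scaleTime s ⟨q, hq'⟩ := projTime_coe (scaleTime s ⟨q, hq'⟩)
  simp only [h1, h2]

theorem hasDerivAt_primitive [CompleteSpace E] (z : C(FlowTime, E)) (r : ℝ) :
    HasDerivAt (fun r => ∫ q in (0 : ℝ)..r, z (projTime q)) (z (projTime r)) r :=
  intervalIntegral.integral_hasDerivAt_right
    ((z.continuous.comp continuous_projTime).intervalIntegrable _ _)
    ((z.continuous.comp continuous_projTime).stronglyMeasurableAtFilter _ _)
    (z.continuous.comp continuous_projTime).continuousAt

/-- Constant maps, as a continuous linear map. -/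
def constCLM (E : Type*) [NormedAddCommGroup E] [NormedSpace ℝ E] : E →L[ℝ] C(FlowTime, E) :=
  LinearMap.mkContinuous
    { toFun := fun x => ContinuousMap.const _ x
      map_add' := fun _ _ => rfl
      map_smul' := fun _ _ => rfl } 1 (by
    intro x
    rw [one_mul]
    exact (ContinuousMap.norm_le _ (norm_nonneg x)).2 fun _ => le_rfl)

theorem constCLM_apply (x : E) (r : FlowTime) : constCLM E x r = x := rfl

/-- The map whose zeros in the last component are the integral curves of `f`, run at speed `τ` and
starting at `x`. -/
def curveMap (f : C(E, E)) (p : ℝ × E × C(FlowTime, E)) : ℝ × E × C(FlowTime, E) :=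
  (p.1, p.2.1, p.2.2 - constCLM E p.2.1 - p.1 • primitive E (f.comp p.2.2))

theorem contDiff_curveMap (f : C(E, E)) (hf : ContDiff ℝ ∞ f) : ContDiff ℝ ∞ (curveMap f) := by
  have h1 := contDiff_postcomp (K := FlowTime) f hf
  have h2 : ContDiff ℝ ∞ fun p : ℝ × E × C(FlowTime, E) => primitive E (f.comp p.2.2) :=
    (primitive E).contDiff.comp (h1.comp (contDiff_snd.comp contDiff_snd))
  have h3 : ContDiff ℝ ∞ fun p : ℝ × E × C(FlowTime, E) => constCLM E p.2.1 :=
    (constCLM E).contDiff.comp (contDiff_fst.comp contDiff_snd)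
  exact contDiff_fst.prodMk ((contDiff_fst.comp contDiff_snd).prodMk
    (((contDiff_snd.comp contDiff_snd).sub h3).sub (contDiff_fst.smul h2)))

/-- The shear `(τ, x, y) ↦ (τ, x, y - x - τ z)`. -/
def curveShear (z : C(FlowTime, E)) :
    (ℝ × E × C(FlowTime, E)) ≃L[ℝ] (ℝ × E × C(FlowTime, E)) :=
  let p1 := ContinuousLinearMap.fst ℝ ℝ (E × C(FlowTime, E))
  let p2 := (ContinuousLinearMap.fst ℝ E C(FlowTime, E)).comp (ContinuousLinearMap.snd ℝ ℝ _)
  let p3 := (ContinuousLinearMap.snd ℝ E C(FlowTime, E)).comp (ContinuousLinearMap.snd ℝ ℝ _)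
  ContinuousLinearEquiv.equivOfInverse
    (p1.prod (p2.prod (p3 - (constCLM E).comp p2 - p1.smulRight z)))
    (p1.prod (p2.prod (p3 + (constCLM E).comp p2 + p1.smulRight z)))
    (fun p => by ext <;> simp [p1, p2, p3]; abel) (fun p => by ext <;> simp [p1, p2, p3]; abel)

theorem hasFDerivAt_curveMap (f : C(E, E)) (hf : ContDiff ℝ ∞ f) (x : E) :
    HasFDerivAt (curveMap f)
      (curveShear (primitive E (f.comp (constCLM E x))) : _ →L[ℝ] ℝ × E × C(FlowTime, E))
      (0, x, constCLM E x) := by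
  have h1 : HasFDerivAt (fun p : ℝ × E × C(FlowTime, E) => p.1)
      (ContinuousLinearMap.fst ℝ ℝ (E × C(FlowTime, E))) (0, x, constCLM E x) := hasFDerivAt_fst
  have h2 : HasFDerivAt (fun p : ℝ × E × C(FlowTime, E) => p.2.1)
      ((ContinuousLinearMap.fst ℝ E C(FlowTime, E)).comp (ContinuousLinearMap.snd ℝ ℝ _))
      (0, x, constCLM E x) := hasFDerivAt_fst.comp _ hasFDerivAt_snd
  have h3 : HasFDerivAt (fun p : ℝ × E × C(FlowTime, E) => p.2.2)
      ((ContinuousLinearMap.snd ℝ E C(FlowTime, E)).comp (ContinuousLinearMap.snd ℝ ℝ _))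
      (0, x, constCLM E x) := hasFDerivAt_snd.comp _ hasFDerivAt_snd
  have h4 : HasFDerivAt (fun p : ℝ × E × C(FlowTime, E) => constCLM E p.2.1) _
      (0, x, constCLM E x) := (constCLM E).hasFDerivAt.comp _ h2
  have h5 : DifferentiableAt ℝ (fun p : ℝ × E × C(FlowTime, E) => primitive E (f.comp p.2.2))
      (0, x, constCLM E x) :=
    ((primitive E).contDiff.comp ((contDiff_postcomp (K := FlowTime) f hf).comp
      (contDiff_snd.comp contDiff_snd))).differentiable (by simp) _
  refine (h1.prodMk (h2.prodMk ((h3.sub h4).sub (h1.smul h5.hasFDerivAt)))).congr_fderiv ?_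
  ext p <;> simp [curveShear]

theorem scaleTime_curve (f : C(E, E)) {τ : ℝ} {x : E} {y : C(FlowTime, E)} (s : FlowTime)
    (h : y = constCLM E x + τ • primitive E (f.comp y)) :
    y.comp (scaleTime s) =
      constCLM E x + (s * τ : ℝ) • primitive E (f.comp (y.comp (scaleTime s))) := by
  have h1 := primitive_comp_scaleTime (f.comp y) s
  ext r
  have h2 := congrArg (fun w : C(FlowTime, E) => w r) h1
  have h3 := congrArg (fun w : C(FlowTime, E) => w (scaleTime s r)) h
  simp only [ContinuousMap.comp_apply, ContinuousMap.smul_apply] at h2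
  simp only [ContinuousMap.add_apply, ContinuousMap.smul_apply, constCLM_apply] at h3
  simp only [ContinuousMap.comp_apply, ContinuousMap.add_apply, ContinuousMap.smul_apply,
    constCLM_apply]
  rw [h3, h2, smul_smul, mul_comm τ]
  rfl

theorem exists_smooth_flow [CompleteSpace E] {f : E → E} (hf : ContDiff ℝ ∞ f) (x₀ : E) :
    ∃ φ : ℝ × E → E, (∀ᶠ p in 𝓝 (0, x₀), ContDiffAt ℝ ∞ φ p) ∧
      (∀ᶠ x in 𝓝 x₀, φ (0, x) = x) ∧
      ∀ᶠ p : ℝ × E in 𝓝 (0, x₀), HasDerivAt (fun t => φ (t, p.2)) (f (φ p)) p.1 := by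
  let F : C(E, E) := ⟨f, hf.continuous⟩
  set c := constCLM E x₀ with hc
  obtain ⟨g, hga, hgs, hgf, hfg⟩ := exists_smooth_local_inverse
    (curveShear (primitive E (F.comp c)))
    (Eventually.of_forall fun p => (contDiff_curveMap F hf).contDiffAt)
    (hasFDerivAt_curveMap F hf x₀)
  have hΓ : curveMap F (0, x₀, c) = (0, x₀, 0) := by simp [curveMap, hc]
  rw [hΓ] at hga hgs hfg
  -- the curve with parameters `p`
  let ι : ℝ × E → ℝ × E × C(FlowTime, E) := fun p => (p.1, p.2, 0)
  have hι : ContDiff ℝ ∞ ι := contDiff_fst.prodMk (contDiff_snd.prodMk contDiff_const)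
  have hι0 : Tendsto ι (𝓝 (0, x₀)) (𝓝 (0, x₀, 0)) := hι.continuous.tendsto (0, x₀)
  let Y : ℝ × E → C(FlowTime, E) := fun p => (g (ι p)).2.2
  have hYs : ∀ᶠ p in 𝓝 (0, x₀), ContDiffAt ℝ ∞ Y p := by
    filter_upwards [hι0.eventually hgs] with p hp
    exact (contDiff_snd.comp contDiff_snd).contDiffAt.comp p (hp.comp p hι.contDiffAt)
  have hY0 : Y (0, x₀) = c := by simp only [Y, ι, hga, hc]
  have hYeq : ∀ᶠ p in 𝓝 (0, x₀), Y p = constCLM E p.2 + p.1 • primitive E (F.comp (Y p)) := by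
    filter_upwards [hι0.eventually hfg] with p hp
    have h1 : (g (ι p)).1 = p.1 := congrArg Prod.fst hp
    have h2 : (g (ι p)).2.1 = p.2 := congrArg (fun q => q.2.1) hp
    have h3 : (g (ι p)).2.2 - constCLM E (g (ι p)).2.1 -
      (g (ι p)).1 • primitive E (F.comp (g (ι p)).2.2) = 0 := congrArg (fun q => q.2.2) hp
    rw [h1, h2, sub_sub, sub_eq_zero] at h3
    exact h3
  have huniq : ∀ᶠ q : ℝ × E × C(FlowTime, E) in 𝓝 (0, x₀, c),
      q.2.2 = constCLM E q.2.1 + q.1 • primitive E (F.comp q.2.2) → q.2.2 = Y (q.1, q.2.1) := by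
    filter_upwards [hgf] with q hq h
    have : curveMap F q = ι (q.1, q.2.1) := by
      refine Prod.ext rfl (Prod.ext rfl ?_)
      change q.2.2 - constCLM E q.2.1 - q.1 • primitive E (F.comp q.2.2) = 0
      rw [sub_sub, sub_eq_zero]
      exact h
    change q.2.2 = (g (ι (q.1, q.2.1))).2.2
    rw [← this, hq]
  obtain ⟨δ, hδ, hball⟩ := Metric.eventually_nhds_iff.1 huniq
  have hYc : ∀ᶠ p in 𝓝 (0, x₀), dist (Y p) c < δ := by
    have := hYs.self_of_nhds.continuousAt
    rw [ContinuousAt, hY0] at this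
    exact this.eventually (Metric.ball_mem_nhds c hδ)
  obtain ⟨ε, hε, hball'⟩ := Metric.eventually_nhds_iff.1 (hYeq.and hYc)
  let one : FlowTime := ⟨1, by norm_num⟩
  let φ : ℝ × E → E := fun p => Y p one
  set η := min δ ε / 2 with hη
  have hη0 : 0 < η := by positivity
  have hηδ : η < δ := by have := min_le_left δ ε; rw [hη]; linarith
  have hηε : η < ε := by have := min_le_right δ ε; rw [hη]; linarith
  have key : ∀ x, dist x x₀ < η → ∀ s : FlowTime, φ (s * η, x) = Y (η, x) s := by
    intro x hx s
    have hp : dist ((η, x) : ℝ × E) (0, x₀) < ε := by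
      rw [Prod.dist_eq, max_lt_iff, Real.dist_eq, sub_zero, abs_of_pos hη0]
      exact ⟨hηε, hx.trans hηε⟩
    obtain ⟨h1, h2⟩ := hball' hp
    have h3 := scaleTime_curve F s h1
    have hs : |(s : ℝ)| ≤ 1 := abs_le.2 s.2
    have h4 : dist ((s * η, x, (Y (η, x)).comp (scaleTime s)) : ℝ × E × C(FlowTime, E))
        (0, x₀, c) < δ := by
      rw [Prod.dist_eq, max_lt_iff, Prod.dist_eq, max_lt_iff]
      refine ⟨?_, hx.trans hηδ, ?_⟩
      · rw [Real.dist_eq, sub_zero, abs_mul, abs_of_pos hη0]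
        nlinarith
      · refine lt_of_le_of_lt ?_ h2
        refine (ContinuousMap.dist_le dist_nonneg).2 fun r => ?_
        exact ContinuousMap.dist_apply_le_dist (f := Y (η, x)) (g := c) (scaleTime s r)
    have h5 := hball h4 h3
    have h6 := congrArg (fun w : C(FlowTime, E) => w one) h5
    change (Y (s * η, x)) one = _
    rw [← h6]
    change Y (η, x) (scaleTime s one) = _
    congr 1
    exact Subtype.ext (mul_one _)
  have hφform : ∀ x, dist x x₀ < η → ∀ t, |t| < η →
      φ (t, x) = x + η • ∫ q in (0 : ℝ)..t / η, F (Y (η, x) (projTime q)) := by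
    intro x hx t ht
    have hp : dist ((η, x) : ℝ × E) (0, x₀) < ε := by
      rw [Prod.dist_eq, max_lt_iff, Real.dist_eq, sub_zero, abs_of_pos hη0]
      exact ⟨hηε, hx.trans hηε⟩
    have hs : t / η ∈ Icc (-1 : ℝ) 1 := by
      refine abs_le.1 ?_
      rw [abs_div, abs_of_pos hη0]
      exact (div_le_one hη0).2 ht.le
    have h1 := key x hx ⟨t / η, hs⟩
    rw [div_mul_cancel₀ t hη0.ne'] at h1
    rw [h1]
    exact congrArg (fun w : C(FlowTime, E) => w ⟨t / η, hs⟩) (hball' hp).1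
  have hx_near : ∀ᶠ x in 𝓝 x₀, dist x x₀ < η := Metric.ball_mem_nhds x₀ hη0
  have ht_near : ∀ᶠ t in 𝓝 (0 : ℝ), |t| < η := by
    filter_upwards [Metric.ball_mem_nhds (0 : ℝ) hη0] with t ht
    simpa [Real.dist_eq] using ht
  refine ⟨φ, ?_, ?_, ?_⟩
  · filter_upwards [hYs] with p hp
    exact (ContinuousMap.evalCLM ℝ one).contDiff.contDiffAt.comp p hp
  · filter_upwards [hx_near] with x hx
    rw [hφform x hx 0 (by simpa using hη0)]
    simp
  · rw [nhds_prod_eq]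
    filter_upwards [prod_mem_prod ht_near hx_near] with p hp
    obtain ⟨ht, hx⟩ := hp
    have hx' : dist p.2 x₀ < η := hx
    have ht' : |p.1| < η := ht
    have hs : p.1 / η ∈ Icc (-1 : ℝ) 1 := by
      refine abs_le.1 ?_
      rw [abs_div, abs_of_pos hη0]
      exact (div_le_one hη0).2 ht'.le
    have h1 := key p.2 hx' ⟨p.1 / η, hs⟩
    rw [div_mul_cancel₀ p.1 hη0.ne'] at h1
    have h2 : HasDerivAt (fun t : ℝ => t / η) (1 / η) p.1 := (hasDerivAt_id p.1).div_const η
    have h3 := (((hasDerivAt_primitive (F.comp (Y (η, p.2))) (p.1 / η)).scomp p.1 h2).const_smul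
      η).const_add p.2
    have h4 : projTime (p.1 / η) = ⟨p.1 / η, hs⟩ := projTime_coe ⟨p.1 / η, hs⟩
    have h5 : η • (1 / η) • (F.comp (Y (η, p.2))) (projTime (p.1 / η)) = f (φ p) := by
      rw [smul_smul, mul_one_div_cancel hη0.ne', one_smul, h4]
      change f (Y (η, p.2) ⟨p.1 / η, hs⟩) = _
      rw [← h1]
    rw [h5] at h3
    refine h3.congr_of_eventuallyEq ?_
    have : ∀ᶠ t in 𝓝 p.1, |t| < η := continuous_abs.continuousAt.eventually (gt_mem_nhds ht')
    filter_upwards [this] with t ht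
    exact hφform p.2 hx' t ht

end Flow

/-! ### Straightening a function on a symplectic vector space -/

section FlowBox

variable {V : Type*} [NormedAddCommGroup V] [NormedSpace ℝ V]

theorem eq_of_fderiv_zero_along_segment {B : V → ℝ} {p e : V}
    (h : ∀ θ ∈ Icc (0 : ℝ) 1, ∃ B' : V →L[ℝ] ℝ, HasFDerivAt B B' (p + θ • e) ∧ B' e = 0) :
    B (p + e) = B p := by
  have hd : ∀ θ ∈ Icc (0 : ℝ) 1, HasDerivAt (fun θ : ℝ => B (p + θ • e)) 0 θ := by
    intro θ hθ
    obtain ⟨B', hB, hz⟩ := h θ hθ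
    have h1 : HasDerivAt (fun θ : ℝ => p + θ • e) e θ := by
      simpa using ((hasDerivAt_id θ).smul_const e).const_add p
    have h2 := hB.comp_hasDerivAt θ h1
    rwa [hz] at h2
  have := constant_of_has_deriv_right_zero (f := fun θ : ℝ => B (p + θ • e)) (a := 0) (b := 1)
    (fun θ hθ => (hd θ hθ).continuousAt.continuousWithinAt)
    (fun θ hθ => (hd θ ⟨hθ.1, hθ.2.le⟩).hasDerivWithinAt) 1 (by norm_num)
  simpa using this

theorem symplectic_exists_sharp [FiniteDimensional ℝ V] {σ : V →L[ℝ] V →L[ℝ] ℝ}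
    (hnd : ∀ v, (∀ w, σ v w = 0) → v = 0) :
    ∃ S : (V →L[ℝ] ℝ) →L[ℝ] V, ∀ α, σ (S α) = α := by
  have hinj : Function.Injective (σ : V →ₗ[ℝ] V →L[ℝ] ℝ) := by
    refine (injective_iff_map_eq_zero _).2 fun v hv => hnd v fun w => ?_
    exact congrArg (fun T : V →L[ℝ] ℝ => T w) hv
  have hfin : Module.finrank ℝ V = Module.finrank ℝ (V →L[ℝ] ℝ) := by
    rw [← LinearEquiv.finrank_eq (LinearMap.toContinuousLinearMap (𝕜 := ℝ) (E := V) (F' := ℝ))]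
    exact (Subspace.dual_finrank_eq (K := ℝ) (V := V)).symm
  let L := LinearEquiv.ofInjectiveOfFinrankEq (σ : V →ₗ[ℝ] V →L[ℝ] ℝ) hinj hfin
  exact ⟨L.symm.toContinuousLinearEquiv, fun α => L.apply_symm_apply α⟩

/-- The data `(σ, e₁, e₂)`: a symplectic form with `σ(e₁, e₂) = 1`. -/
structure SymplecticPair (σ : V →L[ℝ] V →L[ℝ] ℝ) (e₁ e₂ : V) : Prop where
  alt : ∀ v, σ v v = 0
  nondeg : ∀ v, (∀ w, σ v w = 0) → v = 0
  pair : σ e₁ e₂ = 1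

namespace SymplecticPair

variable {σ : V →L[ℝ] V →L[ℝ] ℝ} {e₁ e₂ : V}

theorem swap (h : SymplecticPair σ e₁ e₂) (v w : V) : σ v w = -σ w v := by
  have := h.alt (v + w)
  simp only [map_add, add_apply, h.alt] at this
  linarith

theorem exists_transversal (h : SymplecticPair σ e₁ e₂) [CompleteSpace V]
    {g : V → ℝ} (hg : ContDiff ℝ ∞ g) (hdg : fderiv ℝ g 0 e₂ ≠ 0) :
    ∃ κ : V → V, κ 0 = 0 ∧ (∀ᶠ z in 𝓝 0, ContDiffAt ℝ ∞ κ z) ∧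
      ∀ᶠ z in 𝓝 0, κ z + (g (κ z) - g 0 - σ e₁ (κ z)) • e₂ = z := by
  set d := fderiv ℝ g 0 e₂ with hd
  let l : V →L[ℝ] ℝ := fderiv ℝ g 0 - σ e₁
  have hl : l e₂ = d - 1 := by simp [l, h.pair, hd]
  let T : V ≃L[ℝ] V := ContinuousLinearEquiv.equivOfInverse
    (ContinuousLinearMap.id ℝ V + l.smulRight e₂)
    (ContinuousLinearMap.id ℝ V - (d⁻¹ • l).smulRight e₂)
    (fun v => by
      simp only [add_apply, sub_apply,
        ContinuousLinearMap.id_apply, ContinuousLinearMap.smulRight_apply,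
        smul_apply, map_add, map_smul, hl, smul_eq_mul]
      match_scalars <;> field_simp
      ring)
    (fun v => by
      simp only [add_apply, sub_apply,
        ContinuousLinearMap.id_apply, ContinuousLinearMap.smulRight_apply,
        smul_apply, map_sub, map_smul, hl, smul_eq_mul]
      match_scalars <;> field_simp
      ring)
  let Q : V → V := fun x => x + (g x - g 0 - σ e₁ x) • e₂
  have hQ0 : Q 0 = 0 := by simp [Q]
  have hQ : ContDiff ℝ ∞ Q :=
    contDiff_id.add (((hg.sub contDiff_const).sub (σ e₁).contDiff).smul contDiff_const)
  have hQd : HasFDerivAt Q (T : V →L[ℝ] V) 0 := by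
    have h1 : HasFDerivAt g (fderiv ℝ g 0) 0 := (hg.differentiable (by simp) 0).hasFDerivAt
    exact (hasFDerivAt_id (0 : V)).add (((h1.sub_const (g 0)).sub (σ e₁).hasFDerivAt).smul_const e₂)
  obtain ⟨κ, h0, hs, -, hr⟩ := exists_smooth_local_inverse T
    (Eventually.of_forall fun x => hQ.contDiffAt) hQd
  rw [hQ0] at h0 hs hr
  exact ⟨κ, h0, hs, hr⟩

theorem preserved_of_split (h : SymplecticPair σ e₁ e₂) {α : V →L[ℝ] V}
    (h1 : ∀ w, σ (α e₁) (α w) = σ e₁ w)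
    (h2 : ∀ v w, σ v e₂ = 0 → σ w e₂ = 0 → σ (α v) (α w) = σ v w) (v w : V) :
    σ (α v) (α w) = σ v w := by
  have key : ∀ v, ∃ v₀, σ v₀ e₂ = 0 ∧ v = v₀ + σ v e₂ • e₁ := fun v =>
    ⟨v - σ v e₂ • e₁, by simp [h.pair], by simp⟩
  obtain ⟨v₀, hv, hv'⟩ := key v
  obtain ⟨w₀, hw, hw'⟩ := key w
  have h3 : σ (α v₀) (α e₁) = σ v₀ e₁ := by rw [h.swap, h1, ← h.swap]
  rw [hv', hw']
  simp only [map_add, map_smul, add_apply, smul_apply,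
    h1, h3, h2 v₀ w₀ hv hw]

/-- On a symplectic vector space, a smooth function `g` with `dg(e₂) ≠ 0` at the origin is, up to
a constant, the linear function `σ(e₁, ·)` in suitable symplectic coordinates. -/
theorem exists_straightening (h : SymplecticPair σ e₁ e₂) [FiniteDimensional ℝ V]
    {g : V → ℝ} (hg : ContDiff ℝ ∞ g) (hdg : fderiv ℝ g 0 e₂ ≠ 0) :
    ∃ Ψ : V → V, Ψ 0 = 0 ∧ (∀ᶠ y in 𝓝 0, ContDiffAt ℝ ∞ Ψ y) ∧
      (∀ᶠ y in 𝓝 0, g (Ψ y) = g 0 + σ e₁ y) ∧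
      ∀ᶠ y in 𝓝 0, ∀ v w, σ (fderiv ℝ Ψ y v) (fderiv ℝ Ψ y w) = σ v w := by
  have : CompleteSpace V := FiniteDimensional.complete ℝ V
  obtain ⟨S, hS⟩ := symplectic_exists_sharp h.nondeg
  have hdgs : ContDiff ℝ ∞ (fderiv ℝ g) := hg.fderiv_right (m := ∞) (by simp)
  let X : V → V := fun x => S (fderiv ℝ g x)
  have hX : ContDiff ℝ ∞ X := S.contDiff.comp hdgs
  have hσX : ∀ x w, σ (X x) w = fderiv ℝ g x w := fun x w => by simp only [X, hS]
  obtain ⟨φ, hφs, hφ0, hφd⟩ := exists_smooth_flow hX 0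
  obtain ⟨κ, hκ0, hκs, hκ⟩ := h.exists_transversal hg hdg
  let x₁ : V →L[ℝ] ℝ := σ.flip e₂
  have hx₁e : x₁ e₁ = 1 := h.pair
  let P : V →L[ℝ] V := ContinuousLinearMap.id ℝ V - x₁.smulRight e₁
  have hP : ∀ v, P v = v - x₁ v • e₁ := fun v => rfl
  have hPe : P e₁ = 0 := by rw [hP, hx₁e, one_smul, sub_self]
  have hx₁P : ∀ v, x₁ (P v) = 0 := fun v => by
    rw [hP, map_sub, map_smul, hx₁e, smul_eq_mul, mul_one, sub_self]
  have hPP : ∀ v, P (P v) = P v := fun v => by rw [hP (P v), hx₁P, zero_smul, sub_zero]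
  have hPt : Tendsto P (𝓝 0) (𝓝 0) := by simpa using P.continuous.tendsto 0
  let Ψ : V → V := fun y => φ (x₁ y, κ (P y))
  have hinner : Tendsto (fun y => (x₁ y, κ (P y))) (𝓝 0) (𝓝 (0, 0)) := by
    have h1 : Tendsto x₁ (𝓝 0) (𝓝 0) := by simpa using x₁.continuous.tendsto 0
    have h2 : Tendsto κ (𝓝 0) (𝓝 0) := by
      have := hκs.self_of_nhds.continuousAt
      rwa [ContinuousAt, hκ0] at this
    exact h1.prodMk_nhds (h2.comp hPt)
  have hΨs : ∀ᶠ y in 𝓝 0, ContDiffAt ℝ ∞ Ψ y := by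
    filter_upwards [hinner.eventually hφs, hPt.eventually hκs] with y h1 h2
    exact h1.comp y (x₁.contDiff.contDiffAt.prodMk (h2.comp y P.contDiff.contDiffAt))
  have hΨ0 : Ψ 0 = 0 := by
    simp only [Ψ, map_zero, hκ0]
    exact hφ0.self_of_nhds
  have hΨP : ∀ᶠ y in 𝓝 0, Ψ (P y) = κ (P y) := by
    have h2 : Tendsto (fun y => κ (P y)) (𝓝 0) (𝓝 0) := (continuous_snd.tendsto _).comp hinner
    filter_upwards [h2.eventually hφ0] with y hy
    simp only [Ψ, hPP, hx₁P]
    exact hy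
  have hΨe : ∀ᶠ y in 𝓝 0, fderiv ℝ Ψ y e₁ = X (Ψ y) := by
    filter_upwards [hΨs, hinner.eventually hφd] with y h1 h2
    have h3 : HasDerivAt (fun s : ℝ => y + s • e₁) e₁ 0 := by
      simpa using ((hasDerivAt_id (0 : ℝ)).smul_const e₁).const_add y
    have hy0 : y + (0 : ℝ) • e₁ = y := by simp
    have h4 : HasDerivAt (fun s : ℝ => Ψ (y + s • e₁)) (fderiv ℝ Ψ y e₁) 0 := by
      have := (h1.differentiableAt (by simp)).hasFDerivAt
      rw [← hy0] at this
      have h5 := this.comp_hasDerivAt (0 : ℝ) h3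
      rwa [hy0] at h5
    have h5 : (fun s : ℝ => Ψ (y + s • e₁)) = fun s => φ (x₁ y + s, κ (P y)) := by
      funext s
      simp only [Ψ, map_add, map_smul, hx₁e, hPe, smul_zero, add_zero, smul_eq_mul, mul_one]
    have h6 : HasDerivAt (fun s : ℝ => φ (x₁ y + s, κ (P y))) (X (Ψ y)) 0 := by
      have h7 : HasDerivAt (fun s : ℝ => x₁ y + s) 1 0 := (hasDerivAt_id (0 : ℝ)).const_add (x₁ y)
      have h8 : HasDerivAt (fun t => φ (t, κ (P y))) (X (Ψ y)) (x₁ y + 0) := by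
        rw [add_zero]; exact h2
      have h9 := h8.scomp (0 : ℝ) h7
      rwa [one_smul] at h9
    rw [h5] at h4
    exact h4.unique h6
  have hseg : ∀ {p : V → Prop}, (∀ᶠ y in 𝓝 0, p y) →
      ∀ᶠ y in 𝓝 0, ∀ θ ∈ Icc (0 : ℝ) 1, p (P y + θ • x₁ y • e₁) := by
    intro p hp
    refine isCompact_Icc.eventually_forall_of_forall_eventually fun θ _ => ?_
    have : Tendsto (fun q : V × ℝ => P q.1 + q.2 • x₁ q.1 • e₁) (𝓝 (0, θ)) (𝓝 0) := by
      have hc : Continuous fun q : V × ℝ => P q.1 + q.2 • x₁ q.1 • e₁ := by fun_prop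
      simpa using hc.tendsto (0, θ)
    exact this.eventually hp
  have hPadd : ∀ y, P y + x₁ y • e₁ = y := fun y => by rw [hP]; abel
  have hgΨ : ∀ᶠ y in 𝓝 0, g (Ψ y) = g 0 + σ e₁ y := by
    filter_upwards [hseg (hΨs.and hΨe), hΨP, hPt.eventually hκ] with y h1 h2 h3
    have h4 := eq_of_fderiv_zero_along_segment (B := fun y => g (Ψ y)) (p := P y)
      (e := x₁ y • e₁) fun θ hθ => by
        obtain ⟨h5, h6⟩ := h1 θ hθ
        refine ⟨_, (hg.differentiable (by simp) _).hasFDerivAt.comp _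
          (h5.differentiableAt (by simp)).hasFDerivAt, ?_⟩
        simp only [ContinuousLinearMap.comp_apply, map_smul, h6]
        rw [← hσX, h.alt, smul_zero]
    rw [hPadd] at h4
    have h7 : σ e₁ (P y) = σ e₁ y := by rw [hP, map_sub, map_smul, h.alt, smul_zero, sub_zero]
    have h8 := congrArg (σ e₁) h3
    rw [map_add, map_smul, h.pair, smul_eq_mul, mul_one, h7] at h8
    rw [h4, h2]
    linarith
  have hbase : ∀ᶠ y in 𝓝 0, ∀ v w,
      σ (fderiv ℝ Ψ (P y) v) (fderiv ℝ Ψ (P y) w) = σ v w := by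
    filter_upwards [hPt.eventually hΨs, hPt.eventually hΨe, hPt.eventually hgΨ.eventually_nhds,
      hΨP.eventually_nhds, hPt.eventually hκ.eventually_nhds, hPt.eventually hκs] with y h1 h2 h3 h4
      h5 h6
    have hdΨ := (h1.differentiableAt (by simp)).hasFDerivAt
    have hdκ := (h6.differentiableAt (by simp)).hasFDerivAt
    refine h.preserved_of_split (fun w => ?_) fun v w hv hw => ?_
    · rw [h2, hσX]
      have h7 : HasFDerivAt (fun y => g (Ψ y)) (σ e₁) (P y) :=
        ((σ e₁).hasFDerivAt.const_add (g 0)).congr_of_eventuallyEq h3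
      have h8 := ((hg.differentiable (by simp) _).hasFDerivAt.comp _ hdΨ).unique h7
      exact congrArg (fun T : V →L[ℝ] ℝ => T w) h8
    · have h7 : ∀ v, x₁ v = 0 → fderiv ℝ Ψ (P y) v = fderiv ℝ κ (P y) v := by
        intro v hv
        have hPv : P v = v := by rw [hP, hv, zero_smul, sub_zero]
        have h8 : HasFDerivAt (fun y => Ψ (P y)) ((fderiv ℝ κ (P y)).comp P) y :=
          (hdκ.comp y P.hasFDerivAt).congr_of_eventuallyEq h4
        have h9 := congrArg (fun T : V →L[ℝ] V => T v) ((hdΨ.comp y P.hasFDerivAt).unique h8)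
        simpa [hPv] using h9
      have h8 : ∀ v, ∃ a : ℝ, fderiv ℝ κ (P y) v = v + a • e₂ := by
        intro v
        have h9 := (hg.differentiable (by simp) (κ (P y))).hasFDerivAt.comp (P y) hdκ
        have h10 := hdκ.add (((h9.sub_const (g 0)).sub
          ((σ e₁).hasFDerivAt.comp (P y) hdκ)).smul_const e₂)
        have h11 : HasFDerivAt (fun z => κ z + (g (κ z) - g 0 - σ e₁ (κ z)) • e₂)
          (ContinuousLinearMap.id ℝ V) (P y) := (hasFDerivAt_id _).congr_of_eventuallyEq h5
        have h12 := congrArg (fun T : V →L[ℝ] V => T v) (h10.unique h11)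
        simp only [add_apply, ContinuousLinearMap.smulRight_apply,
          ContinuousLinearMap.id_apply] at h12
        exact ⟨_, by rw [eq_sub_of_add_eq h12, sub_eq_add_neg, ← neg_smul]⟩
      obtain ⟨a, ha⟩ := h8 v
      obtain ⟨b, hb⟩ := h8 w
      rw [h7 v hv, h7 w hw, ha, hb]
      have hw' : σ e₂ w = 0 := by rw [h.swap, hw, neg_zero]
      simp [hv, hw', h.alt]
  refine ⟨Ψ, hΨ0, hΨs, hgΨ, ?_⟩
  filter_upwards [hseg (hΨs.and hΨe.eventually_nhds), hbase] with y h1 h2 v w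
  rw [← h2 v w]
  have h4 := eq_of_fderiv_zero_along_segment
    (B := fun y => σ (fderiv ℝ Ψ y v) (fderiv ℝ Ψ y w)) (p := P y) (e := x₁ y • e₁) fun θ hθ => by
      obtain ⟨h5, h6⟩ := h1 θ hθ
      set z := P y + θ • x₁ y • e₁
      have h7 : ContDiffAt ℝ ∞ (fderiv ℝ Ψ) z := h5.fderiv_right (m := ∞) (by simp)
      have h8 := (h7.differentiableAt (by simp)).hasFDerivAt
      have h9 : ∀ v, HasFDerivAt (fun y => fderiv ℝ Ψ y v)
          ((fderiv ℝ (fderiv ℝ Ψ) z).flip v) z := fun v => by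
        have := h8.clm_apply (hasFDerivAt_const v z)
        refine this.congr_fderiv ?_
        ext; simp
      have hsymm : ∀ v, fderiv ℝ (fderiv ℝ Ψ) z e₁ v =
          S (fderiv ℝ (fderiv ℝ g) (Ψ z) (fderiv ℝ Ψ z v)) := by
        intro v
        have hs : IsSymmSndFDerivAt ℝ Ψ z := h5.isSymmSndFDerivAt (by simp; norm_cast)
        rw [hs e₁ v]
        have h10 : HasFDerivAt (fun y => fderiv ℝ Ψ y e₁)
            ((S.comp (fderiv ℝ (fderiv ℝ g) (Ψ z))).comp (fderiv ℝ Ψ z)) z := by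
          have h11 : HasFDerivAt X (S.comp (fderiv ℝ (fderiv ℝ g) (Ψ z))) (Ψ z) :=
            S.hasFDerivAt.comp _ (hdgs.differentiable (by simp) _).hasFDerivAt
          exact (h11.comp z (h5.differentiableAt (by simp)).hasFDerivAt).congr_of_eventuallyEq h6
        exact congrArg (fun T : V →L[ℝ] V => T v) ((h9 e₁).unique h10)
      have hgs : IsSymmSndFDerivAt ℝ g (Ψ z) :=
        hg.contDiffAt.isSymmSndFDerivAt (by simp; norm_cast)
      refine ⟨_, (σ.hasFDerivAt.comp z (h9 v)).clm_apply (h9 w), ?_⟩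
      simp only [add_apply, ContinuousLinearMap.comp_apply,
        ContinuousLinearMap.flip_apply, map_smul, hsymm, hS,
        Function.comp_apply]
      rw [h.swap, hS, hgs (fderiv ℝ Ψ z w)]
      simp
  rw [hPadd] at h4
  exact h4

end SymplecticPair

end FlowBox

/-! ### Transport of germs along local diffeomorphisms -/

section Transport

variable {E : Type*} [NormedAddCommGroup E] [NormedSpace ℝ E]
  {B : Type*} [TopologicalSpace B] {I : ModelWithCorners ℝ E B}
  {M : Type*} [TopologicalSpace M] [ChartedSpace B M]
  {E' : Type*} [NormedAddCommGroup E'] [NormedSpace ℝ E']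
  {B' : Type*} [TopologicalSpace B'] {I' : ModelWithCorners ℝ E' B'}
  {M' : Type*} [TopologicalSpace M'] [ChartedSpace B' M']

/-- `Ψ` and `Φ` are, near `u` and `v`, smooth and inverse to each other. -/
structure GermDiffeo (I : ModelWithCorners ℝ E B) (I' : ModelWithCorners ℝ E' B')
    (Ψ : M → M') (Φ : M' → M) (u : M) (v : M') : Prop where
  map_left : Ψ u = v
  map_right : Φ v = u
  smooth_left : ∀ᶠ x in 𝓝 u, ContMDiffAt I I' ∞ Ψ x
  smooth_right : ∀ᶠ y in 𝓝 v, ContMDiffAt I' I ∞ Φ y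
  left_inv : ∀ᶠ x in 𝓝 u, Φ (Ψ x) = x
  right_inv : ∀ᶠ y in 𝓝 v, Ψ (Φ y) = y

namespace GermDiffeo

variable {Ψ : M → M'} {Φ : M' → M} {u : M} {v : M'}

theorem symm (h : GermDiffeo I I' Ψ Φ u v) : GermDiffeo I' I Φ Ψ v u :=
  ⟨h.map_right, h.map_left, h.smooth_right, h.smooth_left, h.right_inv, h.left_inv⟩

theorem tendsto (h : GermDiffeo I I' Ψ Φ u v) : Tendsto Ψ (𝓝 u) (𝓝 v) := by
  have := h.smooth_left.self_of_nhds.continuousAt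
  rwa [ContinuousAt, h.map_left] at this

theorem isInvertible (h : GermDiffeo I I' Ψ Φ u v) :
    ∀ᶠ x in 𝓝 u, (mfderiv I I' Ψ x).IsInvertible := by
  filter_upwards [h.smooth_left, h.tendsto.eventually h.smooth_right, h.left_inv.eventually_nhds,
    h.tendsto.eventually h.right_inv.eventually_nhds] with x h1 h2 h3 h4
  have hx : Φ (Ψ x) = x := h3.self_of_nhds
  have hd1 := (h1.mdifferentiableAt (by simp)).hasMFDerivAt
  have hd2 := (h2.mdifferentiableAt (by simp)).hasMFDerivAt
  let A : E →L[ℝ] E' := mfderiv I I' Ψ x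
  let C : E' →L[ℝ] E := mfderiv I' I Φ (Ψ x)
  have e1 : C.comp A = ContinuousLinearMap.id ℝ E := by
    have h5 : HasMFDerivAt I I (Φ ∘ Ψ) x (ContinuousLinearMap.id ℝ E) :=
      (hasMFDerivAt_id x).congr_of_eventuallyEq h3
    exact hasMFDerivAt_unique (hd2.comp x hd1) h5
  have e2 : A.comp C = ContinuousLinearMap.id ℝ E' := by
    have h5 : HasMFDerivAt I' I' (Ψ ∘ Φ) (Ψ x) (ContinuousLinearMap.id ℝ E') :=
      (hasMFDerivAt_id (Ψ x)).congr_of_eventuallyEq h4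
    have h6 : HasMFDerivAt I I' Ψ (Φ (Ψ x)) A := by
      rw [hx]; exact hd1
    exact hasMFDerivAt_unique (h6.comp (Ψ x) hd2) h5
  exact ⟨ContinuousLinearEquiv.equivOfInverse A C
    (fun w => congrArg (fun T : E →L[ℝ] E => T w) e1)
    (fun w => congrArg (fun T : E' →L[ℝ] E' => T w) e2), rfl⟩

/-- Composition with `Ψ`, on functions smooth near a point. -/
def pullbackFunNear (h : GermDiffeo I I' Ψ Φ u v) : smoothNear I' v →ₐ[ℝ] smoothNear I u where
  toFun f := ⟨fun x => f.1 (Ψ x), by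
    filter_upwards [h.smooth_left, h.tendsto.eventually f.2] with x h1 h2 using h2.comp x h1⟩
  map_one' := rfl
  map_mul' _ _ := rfl
  map_zero' := rfl
  map_add' _ _ := rfl
  commutes' _ := rfl

/-- Composition with `Ψ`, on germs of smooth functions. -/
def pullbackFun (h : GermDiffeo I I' Ψ Φ u v) : FunGerm I' v →ₐ[ℝ] FunGerm I u :=
  Ideal.Quotient.liftₐ (nullNear I' v) ((FunGerm.mk I u).comp h.pullbackFunNear) (by
    intro f hf
    rw [AlgHom.comp_apply, ← map_zero (FunGerm.mk I u), FunGerm.mk_eq_iff]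
    exact h.tendsto.eventually hf)

theorem pullbackFun_mk (h : GermDiffeo I I' Ψ Φ u v) (f : smoothNear I' v) :
    h.pullbackFun (FunGerm.mk I' v f) = FunGerm.mk I u (h.pullbackFunNear f) := rfl

theorem pullbackFun_injective (h : GermDiffeo I I' Ψ Φ u v) :
    Function.Injective h.pullbackFun := by
  refine (injective_iff_map_eq_zero _).2 fun f hf => ?_
  obtain ⟨f, rfl⟩ := FunGerm.mk_surjective I' v f
  rw [pullbackFun_mk, ← map_zero (FunGerm.mk I u), FunGerm.mk_eq_iff] at hf
  rw [← map_zero (FunGerm.mk I' v), FunGerm.mk_eq_iff]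
  filter_upwards [h.symm.tendsto.eventually hf, h.right_inv] with y h1 h2
  have h3 : f.1 (Ψ (Φ y)) = 0 := h1
  rwa [h2] at h3

variable [IsManifold I ∞ M] [IsManifold I' ∞ M'] [CompleteSpace E]

/-- Pullback by `Ψ` of vector fields smooth near a point. -/
def pullbackVFNear (h : GermDiffeo I I' Ψ Φ u v) : vfNear I' v →ₗ[ℝ] vfNear I u where
  toFun X := ⟨mpullback I I' Ψ X.1, by
    have : IsManifold I 1 M := IsManifold.of_le (n := ∞) (by simp)
    have : IsManifold I' 1 M' := IsManifold.of_le (n := ∞) (by simp)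
    have hX : SmoothVFNear I' v X.1 := X.2
    change SmoothVFNear I u _
    filter_upwards [h.smooth_left, h.tendsto.eventually hX, h.isInvertible] with x h1 h2 h3
    exact ContMDiffAt.mpullback_vectorField_preimage h2 h1 h3 (by simp)⟩
  map_add' X Y := Subtype.ext (mpullback_add (V := X.1) (V₁ := Y.1))
  map_smul' c X := Subtype.ext (mpullback_const_smul (c := c) (V := X.1))

/-- Pullback by `Ψ` of germs of smooth vector fields, as a linear map. -/
def pullbackVF (h : GermDiffeo I I' Ψ Φ u v) : VFGerm I' v →ₗ[ℝ] VFGerm I u :=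
  (nullVFNear I' v).mapQ (nullVFNear I u) h.pullbackVFNear (by
    intro X hX
    have hX' : ∀ᶠ y in 𝓝 v, X.1 y = 0 := hX
    change ∀ᶠ x in 𝓝 u, mpullback I I' Ψ X.1 x = 0
    filter_upwards [h.tendsto.eventually hX'] with x hx
    rw [mpullback_apply, hx, map_zero])

theorem pullbackVF_mk (h : GermDiffeo I I' Ψ Φ u v) (X : vfNear I' v) :
    h.pullbackVF (VFGerm.mk I' v X) = VFGerm.mk I u (h.pullbackVFNear X) := rfl

theorem pullbackVF_injective (h : GermDiffeo I I' Ψ Φ u v) :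
    Function.Injective h.pullbackVF := by
  refine (injective_iff_map_eq_zero _).2 fun X hX => ?_
  obtain ⟨X, rfl⟩ := VFGerm.mk_surjective I' v X
  rw [pullbackVF_mk, ← map_zero (VFGerm.mk I u), VFGerm.mk_eq_iff] at hX
  rw [← map_zero (VFGerm.mk I' v), VFGerm.mk_eq_iff]
  have h0 : ∀ᶠ x in 𝓝 u, X.1 (Ψ x) = 0 := by
    filter_upwards [hX, h.isInvertible] with x h1 h2
    have h3 : mpullback I I' Ψ X.1 x = 0 := h1
    rw [mpullback_apply] at h3
    have h4 := h2.self_apply_inverse (X.1 (Ψ x))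
    rw [h3, map_zero] at h4
    exact h4.symm
  filter_upwards [h.symm.tendsto.eventually h0, h.right_inv] with y h1 h2
  rw [h2] at h1
  exact h1

theorem lie_pullback (h : GermDiffeo I I' Ψ Φ u v) (X : VFGerm I' v) (f : FunGerm I' v) :
    ⁅h.pullbackVF X, h.pullbackFun f⁆ = h.pullbackFun ⁅X, f⁆ := by
  obtain ⟨X, rfl⟩ := VFGerm.mk_surjective I' v X
  obtain ⟨f, rfl⟩ := FunGerm.mk_surjective I' v f
  rw [pullbackVF_mk, pullbackFun_mk, bracket_mk_fun, bracket_mk_fun, pullbackFun_mk,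
    FunGerm.mk_eq_iff]
  have hf : ∀ᶠ y in 𝓝 v, ContMDiffAt I' 𝓘(ℝ, ℝ) ∞ f.1 y := f.2
  filter_upwards [h.smooth_left, h.isInvertible, h.tendsto.eventually hf] with x h1 h2 h3
  change mvfderiv I (f.1 ∘ Ψ) x (mpullback I I' Ψ X.1 x) = mvfderiv I' f.1 (Ψ x) (X.1 (Ψ x))
  rw [mvfderiv_comp_apply _ (h3.mdifferentiableAt (by simp)) (h1.mdifferentiableAt (by simp))]
  congr 1
  exact h2.self_apply_inverse _

variable [CompleteSpace E']

theorem pullbackVF_pullbackVF_symm (h : GermDiffeo I I' Ψ Φ u v) (X : VFGerm I u) :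
    h.pullbackVF (h.symm.pullbackVF X) = X := by
  obtain ⟨X, rfl⟩ := VFGerm.mk_surjective I u X
  rw [pullbackVF_mk, pullbackVF_mk, VFGerm.mk_eq_iff]
  filter_upwards [h.smooth_left, h.tendsto.eventually h.smooth_right, h.left_inv.eventually_nhds,
    h.tendsto.eventually h.symm.isInvertible, h.isInvertible] with x h1 h2 h3 h4 h5
  change mpullback I I' Ψ (mpullback I' I Φ X.1) x = X.1 x
  have hx : Φ (Ψ x) = x := h3.self_of_nhds
  have hd1 := (h1.mdifferentiableAt (by simp)).hasMFDerivAt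
  have hd2 := (h2.mdifferentiableAt (by simp)).hasMFDerivAt
  have e1 : (mfderiv I' I Φ (Ψ x)).comp (mfderiv I I' Ψ x) = ContinuousLinearMap.id ℝ E := by
    have h5 : HasMFDerivAt I I (Φ ∘ Ψ) x (ContinuousLinearMap.id ℝ E) :=
      (hasMFDerivAt_id x).congr_of_eventuallyEq h3
    exact hasMFDerivAt_unique (hd2.comp x hd1) h5
  have hX : ∀ z, z = x → (X.1 z : E) = (X.1 x : E) := by rintro z rfl; rfl
  set w := mpullback I I' Ψ (mpullback I' I Φ X.1) x with hw
  have h6 : mfderiv I I' Ψ x w = mpullback I' I Φ X.1 (Ψ x) := h5.self_apply_inverse _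
  have h7 : mfderiv I' I Φ (Ψ x) (mpullback I' I Φ X.1 (Ψ x)) = X.1 (Φ (Ψ x)) :=
    h4.self_apply_inverse _
  rw [← h6] at h7
  have h8 := congrArg (fun T : E →L[ℝ] E => T w) e1
  exact (h8.symm.trans h7).trans (hX _ hx)

variable [I.Boundaryless] [I'.Boundaryless]

/-- Pullback by `Ψ` as an isomorphism of Lie algebras of germs of smooth vector fields. -/
def lieEquiv (h : GermDiffeo I I' Ψ Φ u v) : VFGerm I' v ≃ₗ⁅ℝ⁆ VFGerm I u :=
  { LinearEquiv.ofBijective h.pullbackVF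
      ⟨h.pullbackVF_injective, fun X => ⟨_, h.pullbackVF_pullbackVF_symm X⟩⟩ with
    map_lie' := by
      intro X Y
      obtain ⟨X, rfl⟩ := VFGerm.mk_surjective I' v X
      obtain ⟨Y, rfl⟩ := VFGerm.mk_surjective I' v Y
      change h.pullbackVF ⁅VFGerm.mk I' v X, VFGerm.mk I' v Y⁆ =
        ⁅h.pullbackVF (VFGerm.mk I' v X), h.pullbackVF (VFGerm.mk I' v Y)⁆
      rw [bracket_mk_vf, pullbackVF_mk, pullbackVF_mk, pullbackVF_mk, bracket_mk_vf,
        VFGerm.mk_eq_iff]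
      have : IsManifold I (minSmoothness ℝ 2) M := IsManifold.of_le (n := ∞) (by simp; norm_cast)
      have : IsManifold I' (minSmoothness ℝ 2) M' := IsManifold.of_le (n := ∞) (by simp; norm_cast)
      filter_upwards [h.smooth_left, h.tendsto.eventually (SmoothVFNear.mdiff I' X.2),
        h.tendsto.eventually (SmoothVFNear.mdiff I' Y.2)] with x h1 h2 h3
      exact mpullback_mlieBracket h2 h3 h1 (by simp; norm_cast) }

end GermDiffeo

end Transport

/-! ### Vector fields as derivations -/

section Derivation

variable {E : Type*} [NormedAddCommGroup E] [NormedSpace ℝ E]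
  {B : Type*} [TopologicalSpace B] {I : ModelWithCorners ℝ E B}
  {M : Type*} [TopologicalSpace M] [ChartedSpace B M] [IsManifold I ∞ M] {u : M}

theorem lie_mul (X : VFGerm I u) (f g : FunGerm I u) : ⁅X, f * g⁆ = f * ⁅X, g⁆ + ⁅X, f⁆ * g := by
  obtain ⟨X, rfl⟩ := VFGerm.mk_surjective I u X
  obtain ⟨f, rfl⟩ := FunGerm.mk_surjective I u f
  obtain ⟨g, rfl⟩ := FunGerm.mk_surjective I u g
  rw [← map_mul, bracket_mk_fun, bracket_mk_fun, bracket_mk_fun, ← map_mul, ← map_mul, ← map_add,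
    FunGerm.mk_eq_iff]
  have hf : ∀ᶠ x in 𝓝 u, ContMDiffAt I 𝓘(ℝ, ℝ) ∞ f.1 x := f.2
  have hg : ∀ᶠ x in 𝓝 u, ContMDiffAt I 𝓘(ℝ, ℝ) ∞ g.1 x := g.2
  filter_upwards [hf, hg] with x h1 h2
  have h3 := congrArg (fun T => T (X.1 x))
    (mvfderiv_mul (h1.mdifferentiableAt (by simp)) (h2.mdifferentiableAt (by simp)))
  refine h3.trans ?_
  change f.1 x * mvfderiv I g.1 x (X.1 x) + g.1 x * mvfderiv I f.1 x (X.1 x) =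
    f.1 x * mvfderiv I g.1 x (X.1 x) + mvfderiv I f.1 x (X.1 x) * g.1 x
  ring

theorem lie_algebraMap (X : VFGerm I u) (c : ℝ) : ⁅X, algebraMap ℝ (FunGerm I u) c⁆ = 0 := by
  obtain ⟨X, rfl⟩ := VFGerm.mk_surjective I u X
  rw [← AlgHom.commutes (FunGerm.mk I u), bracket_mk_fun, ← map_zero (FunGerm.mk I u),
    FunGerm.mk_eq_iff]
  refine Eventually.of_forall fun x => ?_
  exact congrArg (fun T => T (X.1 x)) (mvfderiv_const (I := I) (x := x) c)

theorem lie_fun_one (X : VFGerm I u) : ⁅X, (1 : FunGerm I u)⁆ = 0 := by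
  simpa using lie_algebraMap X 1

theorem lie_pow_succ (X : VFGerm I u) (f : FunGerm I u) (k : ℕ) :
    ⁅X, f ^ (k + 1)⁆ = (k + 1) * f ^ k * ⁅X, f⁆ := by
  induction k with
  | zero => simp
  | succ k ih =>
    rw [pow_succ, lie_mul, ih]
    push_cast
    ring

variable [I.Boundaryless] [CompleteSpace E]

theorem wedge_dFun_apply (f g : FunGerm I u) (X Y : VFGerm I u) :
    wedge I (dFun I f) (dFun I g) X Y = ⁅X, f⁆ * ⁅Y, g⁆ - ⁅Y, f⁆ * ⁅X, g⁆ := rfl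

theorem sum_wedge_dFun_apply {ι : Type*} [Fintype ι] (p q : ι → FunGerm I u) (X Y : VFGerm I u) :
    (∑ i, wedge I (dFun I (p i)) (dFun I (q i))) X Y =
      ∑ i, (⁅X, p i⁆ * ⁅Y, q i⁆ - ⁅Y, p i⁆ * ⁅X, q i⁆) := by
  simp only [LinearMap.sum_apply, wedge_dFun_apply]

theorem lie_finset_sum {ι : Type*} (s : Finset ι) (X : VFGerm I u) (f : ι → FunGerm I u) :
    ⁅X, ∑ i ∈ s, f i⁆ = ∑ i ∈ s, ⁅X, f i⁆ :=
  map_sum (LieModule.toEnd ℝ (VFGerm I u) (FunGerm I u) X) f s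

theorem extD_eq_sum_wedge {ι : Type*} [Fintype ι] (p q : ι → FunGerm I u) (θ : OneForm I u)
    (h : ∀ X, θ X = ∑ i, p i * ⁅X, q i⁆) :
    extD I θ = ∑ i, wedge I (dFun I (p i)) (dFun I (q i)) := by
  refine LinearMap.ext₂ fun X Y => ?_
  rw [sum_wedge_dFun_apply]
  change ⁅X, θ Y⁆ - ⁅Y, θ X⁆ - θ ⁅X, Y⁆ = _
  simp only [h, lie_finset_sum, lie_mul, lie_lie, ← Finset.sum_sub_distrib]
  refine Finset.sum_congr rfl fun i _ => ?_
  ring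

end Derivation

/-! ### The model algebra -/

section Model

variable {m n : ℕ}

theorem fderiv_coord (x v : EuclideanSpace ℝ (Fin m)) (j : Fin m) :
    fderiv ℝ (fun y : EuclideanSpace ℝ (Fin m) => y j) x v = v j := by
  have : HasFDerivAt (fun y : EuclideanSpace ℝ (Fin m) => y j)
      (EuclideanSpace.proj j : EuclideanSpace ℝ (Fin m) →L[ℝ] ℝ) x :=
    (EuclideanSpace.proj j : EuclideanSpace ℝ (Fin m) →L[ℝ] ℝ).hasFDerivAt
  rw [this.fderiv]
  rfl

theorem lie_mk_coordGerm (X : vfNear (𝓡 m) (0 : EuclideanSpace ℝ (Fin m))) (j : Fin m) :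
    ∃ hj, ⁅VFGerm.mk (𝓡 m) 0 X, coordGerm j⁆ =
      FunGerm.mk (𝓡 m) 0 ⟨fun x => (EuclideanSpace.proj j : EuclideanSpace ℝ (Fin m) →L[ℝ] ℝ) (X.1 x), hj⟩ := by
  have key : (fun x => mvfderiv (𝓡 m) (fun y : EuclideanSpace ℝ (Fin m) => y j) x (X.1 x)) =
      fun x => (EuclideanSpace.proj j : EuclideanSpace ℝ (Fin m) →L[ℝ] ℝ) (X.1 x) := by
    funext x
    refine Eq.trans ?_ (fderiv_coord x (X.1 x) j)
    rw [← mfderiv_eq_fderiv]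
    rfl
  have h := (derivRep (𝓡 m) X ⟨fun x => x j, by
    refine Eventually.of_forall fun x => ContDiffAt.contMDiffAt ?_
    fun_prop⟩).2
  change (fun x => mvfderiv (𝓡 m) (fun y : EuclideanSpace ℝ (Fin m) => y j) x (X.1 x)) ∈ _ at h
  refine ⟨key ▸ h, (FunGerm.mk_eq_iff _).2 (Eventually.of_forall fun x => ?_)⟩
  exact congrFun key x

theorem vfGerm_ext {X Y : VFGerm (𝓡 m) (0 : EuclideanSpace ℝ (Fin m))}
    (h : ∀ j : Fin m, ⁅X, coordGerm j⁆ = ⁅Y, coordGerm j⁆) : X = Y := by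
  obtain ⟨X, rfl⟩ := VFGerm.mk_surjective _ _ X
  obtain ⟨Y, rfl⟩ := VFGerm.mk_surjective _ _ Y
  rw [VFGerm.mk_eq_iff]
  have key : ∀ j, ∀ᶠ x in 𝓝 (0 : EuclideanSpace ℝ (Fin m)),
      (EuclideanSpace.proj j : EuclideanSpace ℝ (Fin m) →L[ℝ] ℝ) (X.1 x) =
        (EuclideanSpace.proj j : EuclideanSpace ℝ (Fin m) →L[ℝ] ℝ) (Y.1 x) := by
    intro j
    obtain ⟨h1, h2⟩ := lie_mk_coordGerm X j
    obtain ⟨h3, h4⟩ := lie_mk_coordGerm Y j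
    have h5 := h j
    rw [h2, h4, FunGerm.mk_eq_iff] at h5
    exact h5
  filter_upwards [eventually_all.2 key] with x hx
  exact PiLp.ext hx

theorem lie_coordVF_coordGerm (i j : Fin m) :
    ⁅(coordVF i : VFGerm (𝓡 m) (0 : EuclideanSpace ℝ (Fin m))), coordGerm j⁆ =
      if i = j then 1 else 0 := by
  obtain ⟨h1, h2⟩ := lie_mk_coordGerm ⟨fun _ => EuclideanSpace.single i (1 : ℝ), by
    refine Eventually.of_forall fun x => ?_
    exact contMDiffAt_vectorSpace_iff_contDiffAt.2 contDiffAt_const⟩ j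
  refine h2.trans ?_
  split_ifs with hij
  · rw [← map_one (FunGerm.mk (𝓡 m) 0), FunGerm.mk_eq_iff]
    refine Eventually.of_forall fun x => ?_
    change EuclideanSpace.single i (1 : ℝ) j = 1
    simp [hij]
  · rw [← map_zero (FunGerm.mk (𝓡 m) 0), FunGerm.mk_eq_iff]
    refine Eventually.of_forall fun x => ?_
    change EuclideanSpace.single i (1 : ℝ) j = 0
    simp [hij]

theorem oddIdx_inj {i j : Fin n} : oddIdx i = oddIdx j ↔ i = j := by
  simp [oddIdx, Fin.ext_iff]

theorem evenIdx_inj {i j : Fin n} : evenIdx i = evenIdx j ↔ i = j := by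
  simp [evenIdx, Fin.ext_iff]

theorem oddIdx_ne_evenIdx (i j : Fin n) : oddIdx i ≠ evenIdx j := by
  simp only [oddIdx, evenIdx, ne_eq, Fin.ext_iff]
  omega

theorem odd_or_even_idx (k : Fin (2 * n)) :
    (∃ i : Fin n, k = oddIdx i) ∨ ∃ i : Fin n, k = evenIdx i := by
  rcases Nat.even_or_odd' k.1 with ⟨c, hc | hc⟩
  · exact Or.inl ⟨⟨c, by omega⟩, Fin.ext hc⟩
  · exact Or.inr ⟨⟨c, by omega⟩, Fin.ext hc⟩

theorem stdForm_apply (X Y : VFGerm (𝓡 (2 * n)) (0 : EuclideanSpace ℝ (Fin (2 * n)))) :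
    stdForm n X Y = ∑ i : Fin n, (⁅X, coordGerm (oddIdx i)⁆ * ⁅Y, coordGerm (evenIdx i)⁆ -
      ⁅Y, coordGerm (oddIdx i)⁆ * ⁅X, coordGerm (evenIdx i)⁆) :=
  sum_wedge_dFun_apply _ _ X Y

theorem stdForm_coordVF_odd (i : Fin n)
    (Y : VFGerm (𝓡 (2 * n)) (0 : EuclideanSpace ℝ (Fin (2 * n)))) :
    stdForm n (coordVF (oddIdx i)) Y = ⁅Y, coordGerm (evenIdx i)⁆ := by
  simp [stdForm_apply, lie_coordVF_coordGerm, oddIdx_inj, oddIdx_ne_evenIdx]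

theorem stdForm_coordVF_even_right (i : Fin n)
    (Y : VFGerm (𝓡 (2 * n)) (0 : EuclideanSpace ℝ (Fin (2 * n)))) :
    stdForm n Y (coordVF (evenIdx i)) = ⁅Y, coordGerm (oddIdx i)⁆ := by
  simp [stdForm_apply, lie_coordVF_coordGerm, evenIdx_inj, (oddIdx_ne_evenIdx _ _).symm]

theorem stdForm_coordVF_odd_right (i : Fin n)
    (Y : VFGerm (𝓡 (2 * n)) (0 : EuclideanSpace ℝ (Fin (2 * n)))) :
    stdForm n Y (coordVF (oddIdx i)) = -⁅Y, coordGerm (evenIdx i)⁆ := by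
  simp [stdForm_apply, lie_coordVF_coordGerm, oddIdx_inj, oddIdx_ne_evenIdx]

/-- A symplectic vector field that annihilates `x²` commutes with `∂/∂x¹`. -/
theorem spInfty_inf_annihilating_le (hn : 0 < n) :
    spInfty n ⊓ annihilating (𝓡 (2 * n)) (coordGerm (evenIdx ⟨0, hn⟩)) ≤
      commutingWith (𝓡 (2 * n)) (coordVF (oddIdx ⟨0, hn⟩)) := by
  rintro X ⟨hX, hX2⟩
  have hX1 := (lieD_eq_zero_iff _).1 hX
  have hX2' : ⁅X, coordGerm (evenIdx ⟨0, hn⟩)⁆ = 0 := hX2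
  set d := coordVF (oddIdx (⟨0, hn⟩ : Fin n))
  have hz : ∀ W, stdForm n ⁅X, d⁆ W = 0 := by
    intro W
    have h1 := hX1 d W
    rw [stdForm_coordVF_odd, stdForm_coordVF_odd, lie_lie, hX2', lie_zero, sub_zero] at h1
    exact right_eq_add.1 h1
  have h0 : ⁅X, d⁆ = 0 := by
    refine vfGerm_ext fun k => ?_
    rw [zero_lie]
    rcases odd_or_even_idx k with ⟨i, rfl⟩ | ⟨i, rfl⟩
    · rw [← stdForm_coordVF_even_right, hz]
    · rw [← neg_eq_zero, ← stdForm_coordVF_odd_right, hz]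
  change ⁅d, X⁆ = 0
  rw [← lie_skew, h0, neg_zero]

theorem spInftyOne_eq (hn : 0 < n) :
    spInftyOne n hn = spInfty n ⊓ annihilating (𝓡 (2 * n)) (coordGerm (evenIdx ⟨0, hn⟩)) := by
  have := spInfty_inf_annihilating_le hn
  unfold spInftyOne
  rw [inf_right_comm, inf_eq_left.2 this]

/-- The germ of the vector field `(x^j)^k ∂/∂x^i`. -/
def powVF (i j : Fin m) (k : ℕ) : VFGerm (𝓡 m) (0 : EuclideanSpace ℝ (Fin m)) :=
  VFGerm.mk (𝓡 m) 0 ⟨fun x => EuclideanSpace.single i ((x j) ^ k), by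
    refine Eventually.of_forall fun x => ?_
    refine contMDiffAt_vectorSpace_iff_contDiffAt.2 ?_
    refine contDiffAt_euclidean.2 fun l => ?_
    by_cases hl : l = i
    · subst hl
      simp only [PiLp.single_apply, if_true]
      fun_prop
    · simp only [PiLp.single_apply, hl, if_false]
      exact contDiffAt_const⟩

theorem lie_powVF (i j l : Fin m) (k : ℕ) :
    ⁅powVF i j k, coordGerm l⁆ = if i = l then coordGerm j ^ k else 0 := by
  obtain ⟨h1, h2⟩ := lie_mk_coordGerm _ l
  refine h2.trans ?_
  split_ifs with hil
  · rw [coordGerm, ← map_pow, FunGerm.mk_eq_iff]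
    refine Eventually.of_forall fun x => ?_
    change EuclideanSpace.single i ((x j) ^ k) l = (x j) ^ k
    simp [hil]
  · rw [← map_zero (FunGerm.mk (𝓡 m) 0), FunGerm.mk_eq_iff]
    refine Eventually.of_forall fun x => ?_
    change EuclideanSpace.single i ((x j) ^ k) l = 0
    simp [hil]

theorem powVF_mem (hn : 0 < n) (k : ℕ) :
    powVF (oddIdx ⟨0, hn⟩) (evenIdx ⟨0, hn⟩) k ∈ spInftyOne n hn := by
  rw [spInftyOne_eq]
  set X := powVF (oddIdx (⟨0, hn⟩ : Fin n)) (evenIdx ⟨0, hn⟩) k with hX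
  have hodd : ∀ i : Fin n, ⁅X, coordGerm (oddIdx i)⁆ =
      if i = ⟨0, hn⟩ then coordGerm (evenIdx ⟨0, hn⟩) ^ k else 0 := fun i => by
    rw [hX, lie_powVF]
    simp only [oddIdx_inj, eq_comm]
  have heven : ∀ i : Fin n, ⁅X, coordGerm (evenIdx i)⁆ = 0 := fun i => by
    rw [hX, lie_powVF, if_neg (oddIdx_ne_evenIdx _ _)]
  refine ⟨(lieD_eq_zero_iff _).2 fun V W => ?_, heven _⟩
  rw [stdForm_apply, stdForm_apply, stdForm_apply, ← Finset.sum_add_distrib, lie_finset_sum]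
  refine Finset.sum_congr rfl fun i _ => ?_
  rw [lie_sub, lie_mul, lie_mul, lie_lie, lie_lie, lie_lie, lie_lie, hodd, heven]
  split_ifs with hi
  · subst hi
    rcases k with _ | k
    · simp only [pow_zero, lie_fun_one, lie_zero]
      ring
    · rw [lie_pow_succ, lie_pow_succ, lie_zero, lie_zero]
      ring
  · simp only [lie_zero]
    ring

theorem linearIndependent_coordGerm_pow (j : Fin m) :
    LinearIndependent ℝ fun k : ℕ => (coordGerm j) ^ k := by
  have h : Transcendental ℝ (coordGerm j) := by
    rw [transcendental_iff]
    intro p hp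
    let x : smoothNear (𝓡 m) (0 : EuclideanSpace ℝ (Fin m)) := ⟨fun x => x j, by
      refine Eventually.of_forall fun x => ContDiffAt.contMDiffAt ?_
      fun_prop⟩
    have hx : coordGerm j = FunGerm.mk (𝓡 m) 0 x := rfl
    rw [hx, Polynomial.aeval_algHom_apply, ← map_zero (FunGerm.mk (𝓡 m) 0),
      FunGerm.mk_eq_iff] at hp
    have hval : ∀ y, (Polynomial.aeval x p).1 y = p.eval (y j) := by
      intro y
      let ev : smoothNear (𝓡 m) (0 : EuclideanSpace ℝ (Fin m)) →ₐ[ℝ] ℝ :=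
        (Pi.evalAlgHom ℝ (fun _ => ℝ) y).comp (Subalgebra.val _)
      have := Polynomial.aeval_algHom_apply ev x p
      rw [Polynomial.coe_aeval_eq_eval] at this
      exact this.symm
    have hcont : Tendsto (fun t : ℝ => EuclideanSpace.single j t) (𝓝 0)
        (𝓝 (0 : EuclideanSpace ℝ (Fin m))) := by
      have hc : Continuous fun t : ℝ => t • EuclideanSpace.single j (1 : ℝ) := by fun_prop
      have h0 := hc.tendsto 0
      rw [zero_smul] at h0
      refine h0.congr fun t => ?_
      ext l
      by_cases hl : l = j <;> simp [hl]
    have hz : ∀ᶠ t in 𝓝 (0 : ℝ), p.eval t = 0 := by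
      filter_upwards [hcont.eventually hp] with t ht
      rw [hval] at ht
      simpa using ht
    exact Polynomial.eq_zero_of_infinite_isRoot p (infinite_of_mem_nhds 0 hz)
  have h1 := (Polynomial.basisMonomials ℝ).linearIndependent.map'
    (Polynomial.aeval (R := ℝ) (coordGerm j)).toLinearMap
    (LinearMap.ker_eq_bot.2 (transcendental_iff_injective.1 h))
  have h2 : (fun k : ℕ => (coordGerm j) ^ k) =
      (Polynomial.aeval (R := ℝ) (coordGerm j)).toLinearMap ∘ Polynomial.basisMonomials ℝ := by
    funext k
    simp
  rw [h2]
  exact h1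

theorem not_finiteDimensional_spInftyOne (hn : 0 < n) :
    ¬ FiniteDimensional ℝ (spInftyOne n hn) := by
  intro hfin
  let L : spInftyOne n hn →ₗ[ℝ] FunGerm (𝓡 (2 * n)) (0 : EuclideanSpace ℝ (Fin (2 * n))) :=
    (dFun (𝓡 (2 * n)) (coordGerm (oddIdx ⟨0, hn⟩))).comp (spInftyOne n hn).toSubmodule.subtype
  let X : ℕ → spInftyOne n hn := fun k => ⟨_, powVF_mem hn k⟩
  have hL : L ∘ X = fun k => coordGerm (evenIdx ⟨0, hn⟩) ^ k := by
    funext k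
    change ⁅powVF (oddIdx ⟨0, hn⟩) (evenIdx ⟨0, hn⟩) k, coordGerm (oddIdx ⟨0, hn⟩)⁆ = _
    rw [lie_powVF, if_pos rfl]
  have hli : LinearIndependent ℝ X :=
    LinearIndependent.of_comp L (hL ▸ linearIndependent_coordGerm_pow _)
  exact (hli.finite).not_infinite inferInstance

end Model

/-! ### Canonical coordinates on the cotangent bundle -/

section CanonicalCoordinates

variable {n : ℕ} {N : Type*} [TopologicalSpace N] [ChartedSpace (EuclideanSpace ℝ (Fin n)) N]
  [IsManifold (𝓡 n) ∞ N]

/-- The canonical chart of `T*N` at `u`. -/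
def cotChart (u : CotangentBundle n N) (β : CotangentBundle n N) :
    EuclideanSpace ℝ (Fin n) × (EuclideanSpace ℝ (Fin n) →L[ℝ] ℝ) :=
  extChartAt (cotangentModel n) u β

theorem cotChart_fst (u β : CotangentBundle n N) :
    (cotChart u β).1 = extChartAt (𝓡 n) u.proj β.proj := by
  rw [cotChart, FiberBundle.extChartAt]
  rfl

theorem cotChart_snd_apply (u β : CotangentBundle n N) (w : EuclideanSpace ℝ (Fin n)) :
    (cotChart u β).2 w = β.snd ((trivializationAt (EuclideanSpace ℝ (Fin n))
      (TangentSpace (𝓡 n) (M := N)) u.proj).symmL ℝ β.proj w) := by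
  rw [cotChart, FiberBundle.extChartAt]
  change ((trivializationAt ℝ (Bundle.Trivial N ℝ) u.proj).continuousLinearMapAt ℝ β.proj)
    (β.snd ((trivializationAt (EuclideanSpace ℝ (Fin n))
      (TangentSpace (𝓡 n) (M := N)) u.proj).symmL ℝ β.proj w)) = _
  simp

theorem tautological_eq_cotChart {u β : CotangentBundle n N}
    (hβ : β.proj ∈ (chartAt (EuclideanSpace ℝ (Fin n)) u.proj).source)
    (V : TangentSpace (cotangentModel n) β) :
    tautological n N β V = (cotChart u β).2
      (mvfderiv (cotangentModel n) (fun γ => (cotChart u γ).1) β V) := by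
  have : IsManifold (𝓡 n) 1 N := IsManifold.of_le (n := ∞) (by simp)
  have h1 : (fun γ : CotangentBundle n N => (cotChart u γ).1) =
      extChartAt (𝓡 n) u.proj ∘ fun γ : CotangentBundle n N => γ.proj :=
    funext fun γ => cotChart_fst u γ
  have hπ : ContMDiff (cotangentModel n) (𝓡 n) ∞ (fun γ : CotangentBundle n N => γ.proj) :=
    Bundle.contMDiff_proj _
  have h2 : MDifferentiableAt (𝓡 n) 𝓘(ℝ, EuclideanSpace ℝ (Fin n)) (extChartAt (𝓡 n) u.proj)
      β.proj := mdifferentiableAt_extChartAt hβ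
  have h4 := mfderiv_comp_apply (I := cotangentModel n) (I' := 𝓡 n)
    (I'' := 𝓘(ℝ, EuclideanSpace ℝ (Fin n)))
    (f := fun γ : CotangentBundle n N => γ.proj) (g := extChartAt (𝓡 n) u.proj) β h2
    ((hπ β).mdifferentiableAt (by simp)) V
  rw [h1]
  refine Eq.trans ?_ (congrArg (cotChart u β).2 h4.symm)
  refine Eq.trans ?_ (cotChart_snd_apply u β _).symm
  set w := mfderiv (cotangentModel n) (𝓡 n) (fun γ : CotangentBundle n N => γ.proj) β V with hw
  change β.snd w = β.snd _
  congr 1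
  have hb : β.proj ∈ (trivializationAt (EuclideanSpace ℝ (Fin n))
      (TangentSpace (𝓡 n) (M := N)) u.proj).baseSet := hβ
  have h3 := (trivializationAt (EuclideanSpace ℝ (Fin n))
    (TangentSpace (𝓡 n) (M := N)) u.proj).symmL_continuousLinearMapAt (R := ℝ) hb w
  rw [TangentBundle.continuousLinearMapAt_trivializationAt hβ] at h3
  exact h3.symm

theorem eventually_proj_mem_source (u : CotangentBundle n N) :
    ∀ᶠ β in 𝓝 u, β.proj ∈ (chartAt (EuclideanSpace ℝ (Fin n)) u.proj).source := by
  have hπ : Continuous (fun γ : CotangentBundle n N => γ.proj) :=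
    (Bundle.contMDiff_proj (n := ∞) (IB := 𝓡 n) (F := EuclideanSpace ℝ (Fin n) →L[ℝ] ℝ)
      (fun x : N => TangentSpace (𝓡 n) x →L[ℝ] ℝ)).continuous
  exact hπ.continuousAt.eventually (chart_source_mem_nhds _ u.proj)

theorem eventually_contMDiffAt_cotChart (u : CotangentBundle n N) :
    ∀ᶠ β in 𝓝 u, ContMDiffAt (cotangentModel n)
      𝓘(ℝ, EuclideanSpace ℝ (Fin n) × (EuclideanSpace ℝ (Fin n) →L[ℝ] ℝ)) ∞ (cotChart u) β := by
  filter_upwards [extChartAt_source_mem_nhds (I := cotangentModel n) u] with β hβ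
  rw [extChartAt_source] at hβ
  exact contMDiffAt_extChartAt' hβ

/-- A linear function of the canonical coordinates at `u`, smooth near `u`. -/
def cotCoordNear (u : CotangentBundle n N)
    (l : EuclideanSpace ℝ (Fin n) × (EuclideanSpace ℝ (Fin n) →L[ℝ] ℝ) →L[ℝ] ℝ) :
    smoothNear (cotangentModel n) u :=
  ⟨fun β => l (cotChart u β), by
    filter_upwards [eventually_contMDiffAt_cotChart u] with β hβ
    exact l.contMDiff.contMDiffAt.comp β hβ⟩

/-- The coordinate `qⁱ` as a linear function. -/
def posFun (i : Fin n) :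
    EuclideanSpace ℝ (Fin n) × (EuclideanSpace ℝ (Fin n) →L[ℝ] ℝ) →L[ℝ] ℝ :=
  (EuclideanSpace.proj i : EuclideanSpace ℝ (Fin n) →L[ℝ] ℝ).comp (ContinuousLinearMap.fst ℝ _ _)

/-- The coordinate `pᵢ` as a linear function. -/
def momFun (i : Fin n) :
    EuclideanSpace ℝ (Fin n) × (EuclideanSpace ℝ (Fin n) →L[ℝ] ℝ) →L[ℝ] ℝ :=
  (ContinuousLinearMap.apply ℝ ℝ (EuclideanSpace.single i (1 : ℝ))).comp
    (ContinuousLinearMap.snd ℝ _ _)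

theorem posFun_apply (i : Fin n)
    (z : EuclideanSpace ℝ (Fin n) × (EuclideanSpace ℝ (Fin n) →L[ℝ] ℝ)) : posFun i z = z.1 i := rfl

theorem momFun_apply (i : Fin n)
    (z : EuclideanSpace ℝ (Fin n) × (EuclideanSpace ℝ (Fin n) →L[ℝ] ℝ)) :
    momFun i z = z.2 (EuclideanSpace.single i (1 : ℝ)) := rfl

theorem covector_apply_eq_sum (p : EuclideanSpace ℝ (Fin n) →L[ℝ] ℝ)
    (w : EuclideanSpace ℝ (Fin n)) :
    p w = ∑ i, p (EuclideanSpace.single i (1 : ℝ)) * w i := by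
  have h : w = ∑ i, w i • EuclideanSpace.single i (1 : ℝ) := by
    ext j
    simp [Finset.sum_apply, Pi.single_apply]
  conv_lhs => rw [h]
  simp [mul_comm]

/-- The canonical symplectic form in canonical coordinates, `Ω = ∑ dpᵢ ∧ dqⁱ`. -/
theorem canonicalForm_eq (u : CotangentBundle n N) :
    canonicalForm n N u = ∑ i : Fin n,
      wedge (cotangentModel n)
        (dFun _ (FunGerm.mk (cotangentModel n) u (cotCoordNear u (momFun i))))
        (dFun _ (FunGerm.mk (cotangentModel n) u (cotCoordNear u (posFun i)))) := by
  refine extD_eq_sum_wedge _ _ _ fun X => ?_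
  obtain ⟨X, rfl⟩ := VFGerm.mk_surjective _ _ X
  simp only [bracket_mk_fun, ← map_mul, ← map_sum]
  refine (FunGerm.mk_eq_iff _).2 ?_
  filter_upwards [eventually_proj_mem_source u, eventually_contMDiffAt_cotChart u] with β hβ hs
  refine (tautological_eq_cotChart hβ (X.1 β)).trans ?_
  rw [covector_apply_eq_sum, AddSubmonoidClass.coe_finsetSum, Finset.sum_apply]
  refine Finset.sum_congr rfl fun i _ => ?_
  change _ = (cotChart u β).2 (EuclideanSpace.single i 1) *
    mvfderiv (cotangentModel n) (fun γ => (cotChart u γ).1 i) β (X.1 β)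
  congr 1
  have h1 : MDifferentiableAt (cotangentModel n) 𝓘(ℝ, EuclideanSpace ℝ (Fin n))
      (fun γ => (cotChart u γ).1) β :=
    ((ContinuousLinearMap.fst ℝ (EuclideanSpace ℝ (Fin n))
      (EuclideanSpace ℝ (Fin n) →L[ℝ] ℝ)).contMDiff.contMDiffAt.comp β hs).mdifferentiableAt
      (by simp)
  have h2 := mvfderiv_comp_apply (I := 𝓘(ℝ, EuclideanSpace ℝ (Fin n))) (I' := cotangentModel n)
    (g := (EuclideanSpace.proj i : EuclideanSpace ℝ (Fin n) →L[ℝ] ℝ))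
    β (EuclideanSpace.proj i : EuclideanSpace ℝ (Fin n) →L[ℝ] ℝ).mdifferentiableAt h1 (X.1 β)
  refine Eq.trans ?_ h2.symm
  have h3 : mfderiv 𝓘(ℝ, EuclideanSpace ℝ (Fin n)) 𝓘(ℝ, ℝ)
      (EuclideanSpace.proj i : EuclideanSpace ℝ (Fin n) →L[ℝ] ℝ) (cotChart u β).1 =
      (EuclideanSpace.proj i : EuclideanSpace ℝ (Fin n) →L[ℝ] ℝ) := by
    rw [mfderiv_eq_fderiv, ContinuousLinearMap.fderiv]
  exact (congrArg (fun T : EuclideanSpace ℝ (Fin n) →L[ℝ] ℝ =>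
    T (mfderiv (cotangentModel n) 𝓘(ℝ, EuclideanSpace ℝ (Fin n)) (fun γ => (cotChart u γ).1) β
      (X.1 β))) h3).symm

end CanonicalCoordinates

/-! ### The standard symplectic vector space -/

section StandardSymplectic

variable {n : ℕ}

/-- The standard symplectic form on the vector space `ℝ²ⁿ`. -/
def stdSymp (n : ℕ) : EuclideanSpace ℝ (Fin (2 * n)) →L[ℝ] EuclideanSpace ℝ (Fin (2 * n)) →L[ℝ] ℝ :=
  ∑ i : Fin n,
    ((EuclideanSpace.proj (oddIdx i) : EuclideanSpace ℝ (Fin (2 * n)) →L[ℝ] ℝ).smulRight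
        (EuclideanSpace.proj (evenIdx i) : EuclideanSpace ℝ (Fin (2 * n)) →L[ℝ] ℝ) -
      (EuclideanSpace.proj (evenIdx i) : EuclideanSpace ℝ (Fin (2 * n)) →L[ℝ] ℝ).smulRight
        (EuclideanSpace.proj (oddIdx i) : EuclideanSpace ℝ (Fin (2 * n)) →L[ℝ] ℝ))

theorem stdSymp_apply (v w : EuclideanSpace ℝ (Fin (2 * n))) :
    stdSymp n v w = ∑ i : Fin n, (v (oddIdx i) * w (evenIdx i) - w (oddIdx i) * v (evenIdx i)) := by
  simp [stdSymp, mul_comm, -Finset.sum_sub_distrib]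

theorem stdSymp_single_odd (i : Fin n) (w : EuclideanSpace ℝ (Fin (2 * n))) :
    stdSymp n (EuclideanSpace.single (oddIdx i) 1) w = w (evenIdx i) := by
  simp [stdSymp_apply, oddIdx_inj, (oddIdx_ne_evenIdx _ _).symm]

theorem stdSymp_single_even (i : Fin n) (w : EuclideanSpace ℝ (Fin (2 * n))) :
    stdSymp n (EuclideanSpace.single (evenIdx i) 1) w = -w (oddIdx i) := by
  simp [stdSymp_apply, evenIdx_inj, oddIdx_ne_evenIdx]

theorem stdSymp_self (v : EuclideanSpace ℝ (Fin (2 * n))) : stdSymp n v v = 0 := by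
  simp [stdSymp_apply]

theorem stdSymp_swap (v w : EuclideanSpace ℝ (Fin (2 * n))) : stdSymp n v w = -stdSymp n w v := by
  simp [stdSymp_apply]

theorem stdSymp_nondegenerate {v : EuclideanSpace ℝ (Fin (2 * n))} (h : ∀ w, stdSymp n v w = 0) :
    v = 0 := by
  ext k
  rcases odd_or_even_idx k with ⟨i, rfl⟩ | ⟨i, rfl⟩
  · have := h (EuclideanSpace.single (evenIdx i) 1)
    rw [stdSymp_swap, stdSymp_single_even, neg_neg] at this
    simpa using this
  · have := h (EuclideanSpace.single (oddIdx i) 1)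
    rw [stdSymp_swap, stdSymp_single_odd, neg_eq_zero] at this
    simpa using this

theorem symplecticPair_stdSymp (i : Fin n) :
    SymplecticPair (stdSymp n) (EuclideanSpace.single (oddIdx i) (1 : ℝ))
      (EuclideanSpace.single (evenIdx i) (1 : ℝ)) where
  alt := stdSymp_self
  nondeg _ := stdSymp_nondegenerate
  pair := by simp [stdSymp_single_odd]

theorem exists_basis_vector_ne_zero
    {α : EuclideanSpace ℝ (Fin n) × (EuclideanSpace ℝ (Fin n) →L[ℝ] ℝ) →L[ℝ] ℝ} (hα : α ≠ 0) :
    ∃ i : Fin n, α (EuclideanSpace.single i 1, 0) ≠ 0 ∨ α (0, EuclideanSpace.proj i) ≠ 0 := by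
  by_contra! hcon
  refine hα (ContinuousLinearMap.ext fun z => ?_)
  have hz : z = ∑ i, (z.1 i • ((EuclideanSpace.single i 1, 0) :
      EuclideanSpace ℝ (Fin n) × (EuclideanSpace ℝ (Fin n) →L[ℝ] ℝ)) +
      z.2 (EuclideanSpace.single i 1) • (0, EuclideanSpace.proj i)) := by
    refine Prod.ext ?_ ?_
    · ext j
      simp [Prod.fst_sum, Pi.single_apply]
    · refine ContinuousLinearMap.ext fun w => ?_
      rw [covector_apply_eq_sum]
      simp [Prod.snd_sum]
  rw [hz, map_sum]
  refine Finset.sum_eq_zero fun i _ => ?_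
  rw [map_add, map_smul, map_smul, (hcon i).1, (hcon i).2, smul_zero, smul_zero, add_zero]

/-- A linear symplectic map from `ℝ²ⁿ` to `ℝⁿ × (ℝⁿ)*` whose value at `∂/∂x²` is not annihilated
by a given non-zero linear form. -/
theorem exists_linear_symplectic (hn : 0 < n)
    {α : EuclideanSpace ℝ (Fin n) × (EuclideanSpace ℝ (Fin n) →L[ℝ] ℝ) →L[ℝ] ℝ} (hα : α ≠ 0) :
    ∃ A : EuclideanSpace ℝ (Fin (2 * n)) →L[ℝ]
        EuclideanSpace ℝ (Fin n) × (EuclideanSpace ℝ (Fin n) →L[ℝ] ℝ),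
      (∀ v w, ∑ i, (momFun i (A v) * posFun i (A w) - momFun i (A w) * posFun i (A v)) =
        stdSymp n v w) ∧ α (A (EuclideanSpace.single (evenIdx ⟨0, hn⟩) 1)) ≠ 0 := by
  obtain ⟨i, hi⟩ := exists_basis_vector_ne_zero hα
  let τ : Equiv.Perm (Fin n) := Equiv.swap ⟨0, hn⟩ i
  have hτ : ∀ j, τ j = ⟨0, hn⟩ ↔ j = i := fun j => by
    rw [← Equiv.eq_symm_apply]
    simp [τ]
  let x : Fin (2 * n) → EuclideanSpace ℝ (Fin (2 * n)) →L[ℝ] ℝ := fun k => EuclideanSpace.proj k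
  have hx : ∀ k v, x k v = v k := fun _ _ => rfl
  rcases hi with hi | hi
  · let A := ∑ j, ((x (evenIdx (τ j))).smulRight ((EuclideanSpace.single j 1, 0) :
      EuclideanSpace ℝ (Fin n) × (EuclideanSpace ℝ (Fin n) →L[ℝ] ℝ)) +
      (x (oddIdx (τ j))).smulRight (0, EuclideanSpace.proj j))
    have hpos : ∀ k v, posFun k (A v) = v (evenIdx (τ k)) := fun k v => by
      simp [A, posFun_apply, hx]
    have hmom : ∀ k v, momFun k (A v) = v (oddIdx (τ k)) := fun k v => by
      simp [A, momFun_apply, hx]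
    refine ⟨A, fun v w => ?_, ?_⟩
    · simp only [hpos, hmom, stdSymp_apply]
      exact Equiv.sum_comp τ
        fun j => v (oddIdx j) * w (evenIdx j) - w (oddIdx j) * v (evenIdx j)
    · have : A (EuclideanSpace.single (evenIdx ⟨0, hn⟩) 1) = (EuclideanSpace.single i 1, 0) := by
        simp [A, hx, evenIdx_inj, oddIdx_ne_evenIdx, hτ]
      rwa [this]
  · let A := ∑ j, ((x (oddIdx (τ j))).smulRight ((EuclideanSpace.single j 1, 0) :
      EuclideanSpace ℝ (Fin n) × (EuclideanSpace ℝ (Fin n) →L[ℝ] ℝ)) +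
      (x (evenIdx (τ j))).smulRight (0, -EuclideanSpace.proj j))
    have hpos : ∀ k v, posFun k (A v) = v (oddIdx (τ k)) := fun k v => by
      simp [A, posFun_apply, hx]
    have hmom : ∀ k v, momFun k (A v) = -v (evenIdx (τ k)) := fun k v => by
      simp [A, momFun_apply, hx]
    refine ⟨A, fun v w => ?_, ?_⟩
    · simp only [hpos, hmom, stdSymp_apply]
      rw [← Equiv.sum_comp τ fun j => v (oddIdx j) * w (evenIdx j) - w (oddIdx j) * v (evenIdx j)]
      refine Finset.sum_congr rfl fun j _ => ?_
      ring
    · have : A (EuclideanSpace.single (evenIdx ⟨0, hn⟩) 1) = -(0, EuclideanSpace.proj i) := by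
        simp [A, hx, evenIdx_inj, oddIdx_ne_evenIdx, hτ]
      rw [this, map_neg]
      exact neg_ne_zero.2 hi

end StandardSymplectic

theorem exists_contDiff_eventuallyEq {V : Type*} [NormedAddCommGroup V] [InnerProductSpace ℝ V]
    {g : V → ℝ} {a : V} (hg : ∀ᶠ x in 𝓝 a, ContDiffAt ℝ ∞ g x) :
    ∃ f : V → ℝ, ContDiff ℝ ∞ f ∧ f =ᶠ[𝓝 a] g := by
  obtain ⟨r, hr, hball⟩ := Metric.eventually_nhds_iff.1 hg
  let χ : ContDiffBump a := ⟨r / 4, r / 2, by positivity, by linarith⟩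
  refine ⟨fun x => χ x * g x, contDiff_iff_contDiffAt.2 fun x => ?_, ?_⟩
  · by_cases hx : dist x a < r
    · exact χ.contDiffAt.mul (hball hx)
    · have hfar : ∀ᶠ y in 𝓝 x, r / 2 < dist y a := by
        refine (continuous_id.dist continuous_const).continuousAt.eventually (lt_mem_nhds ?_)
        change r / 2 < dist x a
        linarith
      refine contDiffAt_const (c := (0 : ℝ)) |>.congr_of_eventuallyEq ?_
      filter_upwards [hfar] with y hy
      rw [χ.zero_of_le_dist hy.le, zero_mul]
  · filter_upwards [χ.eventuallyEq_one] with x hx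
    rw [hx, Pi.one_apply, one_mul]

section TransportSubalgebras

variable {E : Type*} [NormedAddCommGroup E] [NormedSpace ℝ E] [CompleteSpace E]
  {B : Type*} [TopologicalSpace B] {I : ModelWithCorners ℝ E B} [I.Boundaryless]
  {M : Type*} [TopologicalSpace M] [ChartedSpace B M] [IsManifold I ∞ M]
  {E' : Type*} [NormedAddCommGroup E'] [NormedSpace ℝ E'] [CompleteSpace E']
  {B' : Type*} [TopologicalSpace B'] {I' : ModelWithCorners ℝ E' B'} [I'.Boundaryless]
  {M' : Type*} [TopologicalSpace M'] [ChartedSpace B' M'] [IsManifold I' ∞ M']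
  {Ψ : M → M'} {Φ : M' → M} {u : M} {v : M'}

namespace GermDiffeo

theorem mem_preserving_iff (h : GermDiffeo I I' Ψ Φ u v) {η : TwoForm I' v} {η' : TwoForm I u}
    (hη : ∀ X Y, h.pullbackFun (η X Y) = η' (h.lieEquiv X) (h.lieEquiv Y)) (X : VFGerm I' v) :
    X ∈ preserving I' η ↔ h.lieEquiv X ∈ preserving I η' := by
  refine (lieD_eq_zero_iff I').trans (Iff.trans ?_ (lieD_eq_zero_iff I).symm)
  have key : ∀ V W, (⁅X, η V W⁆ = η ⁅X, V⁆ W + η V ⁅X, W⁆) ↔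
      ⁅h.lieEquiv X, η' (h.lieEquiv V) (h.lieEquiv W)⁆ =
      η' ⁅h.lieEquiv X, h.lieEquiv V⁆ (h.lieEquiv W) +
        η' (h.lieEquiv V) ⁅h.lieEquiv X, h.lieEquiv W⁆ := by
    intro V W
    have h1 : h.pullbackFun ⁅X, η V W⁆ =
        ⁅h.lieEquiv X, η' (h.lieEquiv V) (h.lieEquiv W)⁆ := by
      rw [← h.lie_pullback, hη]
      rfl
    have h2 : h.pullbackFun (η ⁅X, V⁆ W + η V ⁅X, W⁆) =
        η' ⁅h.lieEquiv X, h.lieEquiv V⁆ (h.lieEquiv W) +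
        η' (h.lieEquiv V) ⁅h.lieEquiv X, h.lieEquiv W⁆ := by
      rw [map_add, hη, hη, LieEquiv.map_lie, LieEquiv.map_lie]
    rw [← h1, ← h2, h.pullbackFun_injective.eq_iff]
  refine ⟨fun hX V W => ?_, fun hX V W => (key V W).2 (hX _ _)⟩
  have := (key (h.lieEquiv.symm V) (h.lieEquiv.symm W)).1 (hX _ _)
  rwa [LieEquiv.apply_symm_apply, LieEquiv.apply_symm_apply] at this

theorem mem_annihilating_iff (h : GermDiffeo I I' Ψ Φ u v) {f : FunGerm I' v} {f' : FunGerm I u}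
    {c : ℝ} (hf : h.pullbackFun f = algebraMap ℝ _ c + f') (X : VFGerm I' v) :
    X ∈ annihilating I' f ↔ h.lieEquiv X ∈ annihilating I f' := by
  change ⁅X, f⁆ = 0 ↔ ⁅h.pullbackVF X, f'⁆ = 0
  rw [← h.pullbackFun_injective.eq_iff, map_zero, ← h.lie_pullback, hf, lie_add, lie_algebraMap,
    zero_add]

end GermDiffeo

end TransportSubalgebras

/-! ### Straightening a Hamiltonian on the cotangent bundle -/

section Straightening

variable {n : ℕ}

/-- Symplectic coordinates on `ℝⁿ × (ℝⁿ)*` around `a` in which a function with non-zero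
differential at `a` is, up to a constant, the coordinate `x²`. -/
theorem exists_symplectic_coordinates (hn : 0 < n)
    {h : EuclideanSpace ℝ (Fin n) × (EuclideanSpace ℝ (Fin n) →L[ℝ] ℝ) → ℝ}
    {a : EuclideanSpace ℝ (Fin n) × (EuclideanSpace ℝ (Fin n) →L[ℝ] ℝ)}
    (hh : ∀ᶠ z in 𝓝 a, ContDiffAt ℝ ∞ h z) (hd : fderiv ℝ h a ≠ 0) :
    ∃ b : EuclideanSpace ℝ (Fin (2 * n)) →
        EuclideanSpace ℝ (Fin n) × (EuclideanSpace ℝ (Fin n) →L[ℝ] ℝ),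
      b 0 = a ∧ (∀ᶠ y in 𝓝 0, ContDiffAt ℝ ∞ b y) ∧
      (∀ᶠ y in 𝓝 0, h (b y) = h a + y (evenIdx ⟨0, hn⟩)) ∧
      ∀ᶠ y in 𝓝 0, ∀ v w, ∑ i, (momFun i (fderiv ℝ b y v) * posFun i (fderiv ℝ b y w) -
        momFun i (fderiv ℝ b y w) * posFun i (fderiv ℝ b y v)) = stdSymp n v w := by
  obtain ⟨A, hA, hAd⟩ := exists_linear_symplectic hn hd
  let s : EuclideanSpace ℝ (Fin (2 * n)) →
    EuclideanSpace ℝ (Fin n) × (EuclideanSpace ℝ (Fin n) →L[ℝ] ℝ) := fun x => a + A x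
  have hs : ContDiff ℝ ∞ s := contDiff_const.add A.contDiff
  have hs0 : s 0 = a := by simp [s]
  have hst : Tendsto s (𝓝 0) (𝓝 a) := by simpa [hs0] using hs.continuous.tendsto 0
  obtain ⟨g, hg, hgh⟩ := exists_contDiff_eventuallyEq (g := h ∘ s) (a := 0) (by
    filter_upwards [hst.eventually hh] with x hx
    exact hx.comp x hs.contDiffAt)
  have hdg : fderiv ℝ g 0 (EuclideanSpace.single (evenIdx ⟨0, hn⟩) 1) ≠ 0 := by
    have h1 : HasFDerivAt h (fderiv ℝ h a) (s 0) := by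
      rw [hs0]; exact (hh.self_of_nhds.differentiableAt (by simp)).hasFDerivAt
    have h2 := h1.comp (0 : EuclideanSpace ℝ (Fin (2 * n))) (A.hasFDerivAt.const_add a)
    rw [hgh.fderiv_eq, h2.fderiv]
    exact hAd
  obtain ⟨Ψ, hΨ0, hΨs, hgΨ, hΨ⟩ := (symplecticPair_stdSymp ⟨0, hn⟩).exists_straightening hg hdg
  have hΨt : Tendsto Ψ (𝓝 0) (𝓝 0) := by
    have := hΨs.self_of_nhds.continuousAt
    rwa [ContinuousAt, hΨ0] at this
  refine ⟨fun y => s (Ψ y), ?_, ?_, ?_, ?_⟩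
  · simp only [hΨ0, hs0]
  · filter_upwards [hΨs] with y hy
    exact hs.contDiffAt.comp y hy
  · filter_upwards [hgΨ, hΨt.eventually hgh] with y h1 h2
    have h3 : g 0 = h a := by rw [hgh.self_of_nhds, Function.comp_apply, hs0]
    rw [stdSymp_single_odd, h2, h3] at h1
    exact h1
  · filter_upwards [hΨs, hΨ] with y h1 h2 v w
    have h3 : HasFDerivAt (fun y => s (Ψ y)) (A.comp (fderiv ℝ Ψ y)) y :=
      (A.hasFDerivAt.const_add a).comp y (h1.differentiableAt (by simp)).hasFDerivAt
    rw [h3.fderiv]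
    simp only [ContinuousLinearMap.comp_apply, hA, h2]

theorem exists_equiv_of_symplectic
    {L : EuclideanSpace ℝ (Fin (2 * n)) →L[ℝ]
      EuclideanSpace ℝ (Fin n) × (EuclideanSpace ℝ (Fin n) →L[ℝ] ℝ)}
    (hL : ∀ v w, ∑ i, (momFun i (L v) * posFun i (L w) - momFun i (L w) * posFun i (L v)) =
      stdSymp n v w) :
    ∃ e : EuclideanSpace ℝ (Fin (2 * n)) ≃L[ℝ]
      EuclideanSpace ℝ (Fin n) × (EuclideanSpace ℝ (Fin n) →L[ℝ] ℝ), (e : _ →L[ℝ] _) = L := by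
  have hinj : Function.Injective (L : EuclideanSpace ℝ (Fin (2 * n)) →ₗ[ℝ]
      EuclideanSpace ℝ (Fin n) × (EuclideanSpace ℝ (Fin n) →L[ℝ] ℝ)) := by
    refine (injective_iff_map_eq_zero _).2 fun v hv => stdSymp_nondegenerate fun w => ?_
    have hv' : L v = 0 := hv
    rw [← hL, hv']
    simp
  have hfin : Module.finrank ℝ (EuclideanSpace ℝ (Fin (2 * n))) = Module.finrank ℝ
      (EuclideanSpace ℝ (Fin n) × (EuclideanSpace ℝ (Fin n) →L[ℝ] ℝ)) := by
    rw [Module.finrank_prod, ← LinearEquiv.finrank_eq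
      (LinearMap.toContinuousLinearMap (𝕜 := ℝ) (E := EuclideanSpace ℝ (Fin n)) (F' := ℝ))]
    have hdual : Module.finrank ℝ (EuclideanSpace ℝ (Fin n) →ₗ[ℝ] ℝ) = n :=
      (Subspace.dual_finrank_eq (K := ℝ) (V := EuclideanSpace ℝ (Fin n))).trans
        finrank_euclideanSpace_fin
    rw [hdual, finrank_euclideanSpace_fin, finrank_euclideanSpace_fin]
    ring
  exact ⟨(LinearEquiv.ofInjectiveOfFinrankEq _ hinj hfin).toContinuousLinearEquiv, by ext1; rfl⟩

variable {N : Type*} [TopologicalSpace N] [ChartedSpace (EuclideanSpace ℝ (Fin n)) N]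
  [IsManifold (𝓡 n) ∞ N]

theorem eventually_contMDiffAt_cotChart_symm (u : CotangentBundle n N) :
    ∀ᶠ z in 𝓝 (cotChart u u), ContMDiffAt
      𝓘(ℝ, EuclideanSpace ℝ (Fin n) × (EuclideanSpace ℝ (Fin n) →L[ℝ] ℝ)) (cotangentModel n) ∞
      (extChartAt (cotangentModel n) u).symm z := by
  have ht := extChartAt_target_mem_nhds (I := cotangentModel n) u
  filter_upwards [eventually_mem_nhds_iff.2 ht] with z hz
  exact (contMDiffOn_extChartAt_symm u).contMDiffAt hz

theorem fderiv_comp_cotChart_symm_ne_zero {u : CotangentBundle n N} {H : CotangentBundle n N → ℝ}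
    (hdH : mvfderiv (cotangentModel n) H u ≠ 0)
    (hd : DifferentiableAt ℝ (fun z => H ((extChartAt (cotangentModel n) u).symm z))
      (cotChart u u)) :
    fderiv ℝ (fun z => H ((extChartAt (cotangentModel n) u).symm z)) (cotChart u u) ≠ 0 := by
  intro h0
  refine hdH (ContinuousLinearMap.ext fun v => ?_)
  have hfg : H =ᶠ[𝓝 u] (fun z => H ((extChartAt (cotangentModel n) u).symm z)) ∘
      extChartAt (cotangentModel n) u := by
    filter_upwards [extChartAt_source_mem_nhds (I := cotangentModel n) u] with β hβ
    rw [Function.comp_apply, (extChartAt (cotangentModel n) u).left_inv hβ]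
  rw [mvfderiv_comp_extChartAt (cotangentModel n) (mem_extChartAt_source u) hfg hd v]
  exact congrArg (fun T : EuclideanSpace ℝ (Fin n) × (EuclideanSpace ℝ (Fin n) →L[ℝ] ℝ) →L[ℝ] ℝ =>
    T (mfderiv (cotangentModel n) 𝓘(ℝ, _) (extChartAt (cotangentModel n) u) u v)) h0

/-- Local symplectic coordinates of `T*N` in which a non-degenerate Hamiltonian is, up to a
constant, the coordinate `x²`. -/
theorem exists_germDiffeo (hn : 0 < n) {u : CotangentBundle n N} {H : CotangentBundle n N → ℝ}
    (hH : H ∈ smoothNear (cotangentModel n) u) (hdH : mvfderiv (cotangentModel n) H u ≠ 0) :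
    ∃ (Ψ : EuclideanSpace ℝ (Fin (2 * n)) → CotangentBundle n N)
      (Φ : CotangentBundle n N → EuclideanSpace ℝ (Fin (2 * n))),
      GermDiffeo (𝓡 (2 * n)) (cotangentModel n) Ψ Φ 0 u ∧
      (∀ᶠ y in 𝓝 0, H (Ψ y) = H u + y (evenIdx ⟨0, hn⟩)) ∧
      ∀ᶠ y in 𝓝 0, DifferentiableAt ℝ (fun y => cotChart u (Ψ y)) y ∧ ∀ v w,
        ∑ i, (momFun i (fderiv ℝ (fun y => cotChart u (Ψ y)) y v) *
            posFun i (fderiv ℝ (fun y => cotChart u (Ψ y)) y w) -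
          momFun i (fderiv ℝ (fun y => cotChart u (Ψ y)) y w) *
            posFun i (fderiv ℝ (fun y => cotChart u (Ψ y)) y v)) = stdSymp n v w := by
  have hH' : ∀ᶠ x in 𝓝 u, ContMDiffAt (cotangentModel n) 𝓘(ℝ, ℝ) ∞ H x := hH
  let χ := (extChartAt (cotangentModel n) u).symm
  have hχu : χ (cotChart u u) = u := extChartAt_to_inv u
  have hχt : Tendsto χ (𝓝 (cotChart u u)) (𝓝 u) := by
    have := (eventually_contMDiffAt_cotChart_symm u).self_of_nhds.continuousAt
    rwa [ContinuousAt, show (extChartAt (cotangentModel n) u).symm (cotChart u u) = u from hχu]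
      at this
  have hh : ∀ᶠ z in 𝓝 (cotChart u u), ContDiffAt ℝ ∞ (fun z => H (χ z)) z := by
    filter_upwards [eventually_contMDiffAt_cotChart_symm u, hχt.eventually hH'] with z h1 h2
    exact (h2.comp z h1).contDiffAt
  obtain ⟨b, hb0, hbs, hbH, hbσ⟩ := exists_symplectic_coordinates hn hh
    (fderiv_comp_cotChart_symm_ne_zero hdH
      (hh.self_of_nhds.differentiableAt (by simp)))
  have hbt : Tendsto b (𝓝 0) (𝓝 (cotChart u u)) := by
    have := hbs.self_of_nhds.continuousAt
    rwa [ContinuousAt, hb0] at this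
  obtain ⟨e, he⟩ := exists_equiv_of_symplectic hbσ.self_of_nhds
  obtain ⟨c, hc0, hcs, hcb, hbc⟩ := exists_smooth_local_inverse e hbs
    (he ▸ (hbs.self_of_nhds.differentiableAt (by simp)).hasFDerivAt)
  rw [hb0] at hc0 hcs hbc
  have hcχ : ∀ᶠ z in 𝓝 (cotChart u u), cotChart u (χ z) = z := by
    filter_upwards [extChartAt_target_mem_nhds (I := cotangentModel n) u] with z hz
    exact (extChartAt (cotangentModel n) u).right_inv hz
  have hχc : ∀ᶠ β in 𝓝 u, χ (cotChart u β) = β := by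
    filter_upwards [extChartAt_source_mem_nhds (I := cotangentModel n) u] with β hβ
    exact (extChartAt (cotangentModel n) u).left_inv hβ
  have hct : Tendsto (cotChart u) (𝓝 u) (𝓝 (cotChart u u)) :=
    (eventually_contMDiffAt_cotChart u).self_of_nhds.continuousAt
  have hcχb : ∀ᶠ y in 𝓝 0, cotChart u (χ (b y)) = b y := hbt.eventually hcχ
  refine ⟨fun y => χ (b y), fun β => c (cotChart u β), ?_, ?_, ?_⟩
  · refine ⟨?_, hc0, ?_, ?_, ?_, ?_⟩
    · simp only [hb0, hχu]
    · filter_upwards [hbs, hbt.eventually (eventually_contMDiffAt_cotChart_symm u)] with y h1 h2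
      exact h2.comp y h1.contMDiffAt
    · filter_upwards [eventually_contMDiffAt_cotChart u, hct.eventually hcs] with β h1 h2
      exact h2.contMDiffAt.comp β h1
    · filter_upwards [hcχb, hcb] with y h1 h2
      rw [h1, h2]
    · filter_upwards [hct.eventually hbc, hχc] with β h1 h2
      rw [h1, h2]
  · filter_upwards [hbH] with y hy
    rw [hχu] at hy
    exact hy
  · filter_upwards [hcχb.eventually_nhds, hbs, hbσ] with y h1 h2 h3
    have h4 : (fun y => cotChart u (χ (b y))) =ᶠ[𝓝 y] b := h1
    refine ⟨(h2.differentiableAt (by simp)).congr_of_eventuallyEq h4, fun v w => ?_⟩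
    rw [h4.fderiv_eq]
    exact h3 v w

theorem stdForm_mk (X Y : vfNear (𝓡 (2 * n)) (0 : EuclideanSpace ℝ (Fin (2 * n))))
    (f : smoothNear (𝓡 (2 * n)) (0 : EuclideanSpace ℝ (Fin (2 * n))))
    (hf : ∀ᶠ y in 𝓝 0, f.1 y = stdSymp n (X.1 y) (Y.1 y)) :
    stdForm n (VFGerm.mk _ 0 X) (VFGerm.mk _ 0 Y) = FunGerm.mk _ 0 f := by
  rw [stdForm_apply]
  choose hX hX' using fun j => lie_mk_coordGerm X j
  choose hY hY' using fun j => lie_mk_coordGerm Y j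
  simp only [hX', hY', ← map_mul, ← map_sub, ← map_sum]
  refine (FunGerm.mk_eq_iff _).2 ?_
  filter_upwards [hf] with y hy
  refine Eq.trans ?_ ((stdSymp_apply (X.1 y) (Y.1 y)).symm.trans hy.symm)
  rw [AddSubmonoidClass.coe_finsetSum, Finset.sum_apply]
  rfl

theorem pullbackFun_canonicalForm {u : CotangentBundle n N}
    {Ψ : EuclideanSpace ℝ (Fin (2 * n)) → CotangentBundle n N}
    {Φ : CotangentBundle n N → EuclideanSpace ℝ (Fin (2 * n))}
    (h : GermDiffeo (𝓡 (2 * n)) (cotangentModel n) Ψ Φ 0 u)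
    (hσ : ∀ᶠ y in 𝓝 0, DifferentiableAt ℝ (fun y => cotChart u (Ψ y)) y ∧ ∀ v w,
        ∑ i, (momFun i (fderiv ℝ (fun y => cotChart u (Ψ y)) y v) *
            posFun i (fderiv ℝ (fun y => cotChart u (Ψ y)) y w) -
          momFun i (fderiv ℝ (fun y => cotChart u (Ψ y)) y w) *
            posFun i (fderiv ℝ (fun y => cotChart u (Ψ y)) y v)) = stdSymp n v w)
    (X Y : VFGerm (cotangentModel n) u) :
    h.pullbackFun (canonicalForm n N u X Y) = stdForm n (h.pullbackVF X) (h.pullbackVF Y) := by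
  rw [canonicalForm_eq, sum_wedge_dFun_apply, map_sum]
  simp only [map_sub, map_mul, ← h.lie_pullback]
  obtain ⟨X', hX'⟩ := VFGerm.mk_surjective _ _ (h.pullbackVF X)
  obtain ⟨Y', hY'⟩ := VFGerm.mk_surjective _ _ (h.pullbackVF Y)
  simp only [← hX', ← hY', GermDiffeo.pullbackFun_mk, bracket_mk_fun, ← map_mul, ← map_sub,
    ← map_sum]
  refine (stdForm_mk X' Y' _ ?_).symm
  filter_upwards [hσ] with y ⟨hy, hy'⟩
  refine Eq.trans ?_ (hy' (X'.1 y) (Y'.1 y))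
  rw [AddSubmonoidClass.coe_finsetSum, Finset.sum_apply]
  have key : ∀ (l : EuclideanSpace ℝ (Fin n) × (EuclideanSpace ℝ (Fin n) →L[ℝ] ℝ) →L[ℝ] ℝ)
      (Z : vfNear (𝓡 (2 * n)) (0 : EuclideanSpace ℝ (Fin (2 * n)))),
      (derivRep (𝓡 (2 * n)) Z (h.pullbackFunNear (cotCoordNear u l))).1 y =
        l (fderiv ℝ (fun y => cotChart u (Ψ y)) y (Z.1 y)) := by
    intro l Z
    have h1 : HasFDerivAt (fun y => l (cotChart u (Ψ y)))
        (l.comp (fderiv ℝ (fun y => cotChart u (Ψ y)) y)) y :=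
      l.hasFDerivAt.comp y hy.hasFDerivAt
    have h2 := congrArg (fun T : EuclideanSpace ℝ (Fin (2 * n)) →L[ℝ] ℝ => T (Z.1 y)) h1.fderiv
    rw [← mfderiv_eq_fderiv] at h2
    exact h2
  refine Finset.sum_congr rfl fun i _ => ?_
  refine Eq.trans ?_ (congrArg₂ (· - ·)
    (congrArg₂ (· * ·) (key (momFun i) X') (key (posFun i) Y'))
    (congrArg₂ (· * ·) (key (momFun i) Y') (key (posFun i) X')))
  rfl

end Straightening

/-- The Lie algebra of germs of symmetries of a non-degenerate Hamiltonian is isomorphic to the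
model algebra. -/
theorem nonempty_spH_lieEquiv {n : ℕ} (hn : 0 < n) {N : Type*} [TopologicalSpace N]
    [ChartedSpace (EuclideanSpace ℝ (Fin n)) N] [IsManifold (𝓡 n) ∞ N]
    {u : CotangentBundle n N} {H : CotangentBundle n N → ℝ}
    (hH : H ∈ smoothNear (cotangentModel n) u)
    (hdH : mvfderiv (cotangentModel n) H u ≠ 0) :
    Nonempty (spH n N (FunGerm.mk (cotangentModel n) u ⟨H, hH⟩) ≃ₗ⁅ℝ⁆ spInftyOne n hn) := by
  obtain ⟨Ψ, Φ, h, hHΨ, hσ⟩ := exists_germDiffeo hn hH hdH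
  have hHpull : h.pullbackFun (FunGerm.mk (cotangentModel n) u ⟨H, hH⟩) =
      algebraMap ℝ _ (H u) + coordGerm (evenIdx ⟨0, hn⟩) := by
    rw [GermDiffeo.pullbackFun_mk, ← AlgHom.commutes (FunGerm.mk (𝓡 (2 * n)) 0), coordGerm,
      ← map_add, FunGerm.mk_eq_iff]
    exact hHΨ
  have hmem : ∀ X, X ∈ spH n N (FunGerm.mk (cotangentModel n) u ⟨H, hH⟩) ↔
      h.lieEquiv X ∈ spInftyOne n hn := by
    intro X
    rw [spInftyOne_eq]
    exact and_congr (h.mem_preserving_iff (pullbackFun_canonicalForm h hσ) X)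
      (h.mem_annihilating_iff hHpull X)
  refine ⟨LieEquiv.ofSubalgebras _ _ h.lieEquiv (LieSubalgebra.ext _ _ fun Y => ?_)⟩
  rw [LieSubalgebra.mem_map]
  constructor
  · rintro ⟨X, hX, rfl⟩
    exact (hmem X).1 hX
  · intro hY
    refine ⟨h.lieEquiv.symm Y, (hmem _).2 ?_, h.lieEquiv.apply_symm_apply Y⟩
    rwa [LieEquiv.apply_symm_apply]

end GermSymm

end

theorem mainTheorem8 {n : ℕ} (hn : 0 < n) {N : Type*} [TopologicalSpace N]
    [ChartedSpace (EuclideanSpace ℝ (Fin n)) N] [IsManifold (𝓡 n) ∞ N]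
    {U : Set (GermSymm.CotangentBundle n N)} (hU : IsOpen U)
    {H : GermSymm.CotangentBundle n N → ℝ}
    (hH : ContMDiffOn (GermSymm.cotangentModel n) 𝓘(ℝ, ℝ) ∞ H U)
    {u : GermSymm.CotangentBundle n N} (hu : u ∈ U)
    (hdH : mvfderiv (GermSymm.cotangentModel n) H u ≠ 0) :
    Nonempty
      (GermSymm.spH n N (GermSymm.FunGerm.mk (GermSymm.cotangentModel n) u
          ⟨H, GermSymm.mem_smoothNear_of_contMDiffOn hU hH hu⟩) ≃ₗ⁅ℝ⁆
        GermSymm.spInftyOne n hn) ∧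
      ¬ FiniteDimensional ℝ (GermSymm.spInftyOne n hn) :=
  ⟨GermSymm.nonempty_spH_lieEquiv hn _ hdH, GermSymm.not_finiteDimensional_spInftyOne hn⟩
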